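/- **Setting.** Let $\mathfrak f_{4(4)}$ act in its real 26-dimensional representation, with Cartan generators $\mathcal H_1,\dots,\mathcal H_4$ and step operators $E^{\pm\beta}$ in the Cartan–Weyl normalisation $[\mathcal H_i,E^{\pm\beta}]=\pm\beta^iE^{\pm\beta}$, $[E^\beta,E^{-\beta}]=\beta\cdot\mathcal H$. The positive roots $\beta_1,\dots,\beta_{24}$ are, in this order, $(-1,-1,-1,1)$, $(0,0,2,0)$, $(0,1,-1,0)$, $(1,-1,0,0)$, $(-1,-1,1,1)$, $(0,1,1,0)$, $(1,0,-1,0)$, $(-1,0,0,1)$, $(0,2,0,0)$, $(1,0,1,0)$, $(-1,1,-1,1)$, $(0,-1,0,1)$, $(1,1,0,0)$, $(-1,1,1,1)$, $(0,0,-1,1)$, $(2,0,0,0)$, $(0,0,1,1)$, $(1,-1,-1,1)$, $(0,1,0,1)$, $(1,-1,1,1)$, $(1,0,0,1)$, $(1,1,-1,1)$, $(1,1,1,1)$, $(0,0,0,2)$. Put $H_k=E^{\beta_k}-E^{-\beta_k}$, $L_0=\tfrac12\mathcal H_4$, $L_\pm=\tfrac1{\sqrt2}E^{\pm\beta_{24}}$,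 $\mathfrak S=L_+-L_-$. The $\mathfrak{su}(2)$ factor of the isotropy algebra $\mathfrak{su}(2)\oplus\mathfrak{usp}(6)$ is spanned by $$J^1=\tfrac{H_1-H_{14}+H_{20}-H_{22}}{4\sqrt2},\quad J^2=\tfrac{H_5+H_{11}-H_{18}+H_{23}}{4\sqrt2},\quad J^3=-\tfrac{H_2-H_9+H_{16}+H_{24}}{4\sqrt2}.$$ The positive step operators $\mathcal E^{\alpha_1},\dots,\mathcal E^{\alpha_9}$ of $\mathfrak{sp}(6,\mathbb R)\subset\mathfrak f_{4(4)}$ are $E^{\beta_4},E^{\beta_3},E^{\beta_2},E^{\beta_7},-E^{\beta_6},E^{\beta_{10}},-E^{\beta_9},E^{\beta_{13}},E^{\beta_{16}}$, and the Heisenberg generators $W_1,\dots,W_{14}$ are $E^{\beta_5},E^{\beta_{20}},E^{\beta_{14}},-E^{\beta_{23}},E^{\beta_{21}},E^{\beta_{19}},-E^{\beta_{17}},-E^{\beta_{22}},-E^{\beta_{11}},-E^{\beta_{18}},-E^{\beta_1},-E^{\beta_8},-E^{\beta_{12}},-E^{\beta_{15}}$. The signs of the $E^{\beta}$ are those for which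 $[J^x,J^y]=\epsilon^{xyz}J^z$, the $\mathcal E^{\alpha_i}$ have the commutators of the standard step operators of $\mathfrak{sp}(6,\mathbb R)$ in 6 dimensions and the $W_m$ form the standard basis of the $\mathbf{14}'$; such a choice exists. One such choice, fixed explicitly, is used below. Coordinates on $\mathrm F_{4(4)}/(\mathrm{SU}(2)\times\mathrm{USp}(6))$ are $(U,a,h_1,h_2,h_3,p_1,\dots,p_9,Z_1,\dots,Z_{14})\in\mathbb R^{28}$, with coset representative $$\mathbb L=e^{aL_+}\,e^{\sum_{m\ \mathrm{odd}}Z_mW_m}\,e^{\sum_{m\ \mathrm{even}}Z_mW_m}\,e^{p_9\mathcal E^{\alpha_9}}\cdots e^{p_1\mathcal E^{\alpha_1}}\,e^{h_1\mathcal H_1+h_2\mathcal H_2+h_3\mathcal H_3}\,e^{UL_0}.$$ For $\mathfrak t\in\mathfrak f_{4(4)}$ let $\mathcal P^x_{\mathfrak t}=\mathrm{Tr}_{26}(J^x\,\mathbb L^{-1}\mathfrak t\,\mathbb L)$ and $V_{\mathfrak t}=\sum_{x=1}^3(\mathcal P^x_{\mathfrak t})^2$. The coset carries its invariant metric $g$: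 if $\mathbb L^{-1}d\mathbb L=\sum_ie^i\mathcal H_i+\sum_{k}e^{k}E^{\beta_k}$ then $ds^2=\sum_i(e^i)^2+\tfrac12\sum_k(e^{k})^2=\tfrac14dU^2+dh_1^2+dh_2^2+dh_3^2+\cdots$. For a potential $V$, and any smooth pseudo-Riemannian metric $\gamma$ on $\mathbb R^4$, consider the Lagrangian $\sqrt{|\det\gamma|}\,\big(\gamma^{\mu\nu}g_{IJ}\,\partial_\mu\phi^I\partial_\nu\phi^J-V(\phi)\big)$. A map $F$ from a smaller space of fields into the coordinate space is a *consistent truncation* if, for every $C^2$ configuration $\psi$ of the smaller set of fields and at every point, the full set of field equations for $\phi=F(\psi)$ is equivalent to the field equations for $\psi$ of the pulled-back Lagrangian. Call a function $V(\varphi)$ *Starobinsky-like with parameter $\alpha$* if $V(\varphi)=C\,\big(1-e^{-\sqrt{2/(3\alpha)}\,(\varphi-\varphi_0)}\big)^2$ for some $C>0$ and $\varphi_0\in\mathbb R$. **Theorem.** Let $\beta_1,\beta_2,\beta_3,\kappa,\kappa_1,\kappa_2,\kappa_3$ be real (here the $\beta_i$ are parameters, not roots), $$\mathfrak t_{STU}=\beta_3\mathcal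 E^{\alpha_3}+\beta_2\mathcal E^{\alpha_7}+\beta_1\mathcal E^{\alpha_9}-\kappa\,\mathfrak S,\qquad V_{STU}=V_{\mathfrak t_{STU}},$$ $$\mathfrak t_S=\beta_3\mathcal E^{\alpha_3}-\kappa_3\mathfrak S,\quad \mathfrak t_T=\beta_2\mathcal E^{\alpha_7}-\kappa_2\mathfrak S,\quad \mathfrak t_U=\beta_1\mathcal E^{\alpha_9}-\kappa_1\mathfrak S,\qquad \widehat V_{STU}=V_{\mathfrak t_S}+V_{\mathfrak t_T}+V_{\mathfrak t_U}.$$ 1. $\mathfrak t_S,\mathfrak t_T,\mathfrak t_U$ commute with each other. 2. Let $V$ be $V_{STU}$ or $\widehat V_{STU}$. At every point with $Z=U=a=0$ one has $\partial_{Z_m}V=\partial_UV=\partial_aV=0$ for all $m$; at every point with $Z=U=a=p=0$ also $\partial_{p_r}V=0$ for all $r$. Setting $Z=U=a=p=0$ is a consistent truncation to the three dilatons $h_i$. The pulled-back Lagrangian has kinetic metric $dh_1^2+dh_2^2+dh_3^2$, and its potential is, respectively, $$V_{STU}\big|_{Z=U=a=p=0}=\tfrac94\Big(2\kappa-\sqrt2\sum_{i=1}^3\beta_ie^{-2h_i}\Big)^2,\qquad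 \widehat V_{STU}\big|_{Z=U=a=p=0}=\tfrac94\sum_{i=1}^3\big(2\kappa_i-\sqrt2\,e^{-2h_i}\beta_i\big)^2 .$$ 3. Suppose that not all $\beta_i$ vanish, let $q\in\{1,2,3\}$ be the number of non-zero $\beta_i$ and $\alpha=q/3$, so that $\alpha\in\{\tfrac13,\tfrac23,1\}$. Consider the locus $Z=U=a=p=0$, $h_i=\frac{\varphi}{\sqrt{2q}}+\tfrac12\log|\beta_i|$ if $\beta_i\ne0$, and $h_i=c_i$ an arbitrary constant if $\beta_i=0$. Thus for $\beta_i\in\{0,\pm1\}$ all dilatons $h_i$ with $\beta_i\ne0$ are set equal to $h=\varphi/\sqrt{2q}$. (a) If all non-zero $\beta_i$ have the same sign $\varepsilon=\pm1$, this is a consistent truncation of the theory with potential $V_{STU}$. The pulled-back Lagrangian has the canonical kinetic term $\tfrac12(\partial\varphi)^2$ and the potential $$V_{\rm eff}(\varphi)=\tfrac94\Big(2\kappa-\sqrt2\,\varepsilon\,q\,e^{-\sqrt{2/(3\alpha)}\,\varphi}\Big)^2,$$ which is Starobinsky-like with parameter $\alpha=q/3$ if $\varepsilon\kappa>0$. (b)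 If there is a real $k$ with $\kappa_i=k\,\mathrm{sign}(\beta_i)$ for all $i$ with $\beta_i\ne0$, this is a consistent truncation of the theory with potential $\widehat V_{STU}$. The pulled-back Lagrangian has the kinetic term $\tfrac12(\partial\varphi)^2$ and the potential $$\widehat V_{\rm eff}(\varphi)=\tfrac94\,q\,\Big(2k-\sqrt2\,e^{-\sqrt{2/(3\alpha)}\,\varphi}\Big)^2+9\sum_{i:\,\beta_i=0}\kappa_i^2,$$ which is Starobinsky-like with parameter $\alpha=q/3$ if $k>0$ and $\kappa_i=0$ whenever $\beta_i=0$. -/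

import Mathlib

open scoped ContDiff

namespace MultiStar

noncomputable section

/-! ## The split Lie algebra `f4(4)` in its real 26-dimensional representation

The weights of the 26-dimensional representation are the 24 short roots of `F4` and the weight `0`
with multiplicity two.  The basis vectors `v_μ` (`Sum.inl`) are labelled by the short roots `μ`, the
two zero-weight vectors `z_3`, `z_4` (`Sum.inr`) by the two short simple roots `β₃`, `β₄`. -/

/-- The index set of the basis of the 26-dimensional representation. -/
abbrev Idx := Fin 24 ⊕ Fin 2

/-- The 24 short roots of `F4`. -/
def shortRoot : Fin 24 → Fin 4 → ℤ :=
  ![![1, 1, 0, 0], ![1, -1, 0, 0], ![-1, 1, 0, 0], ![-1, -1, 0, 0],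
    ![1, 0, 1, 0], ![1, 0, -1, 0], ![-1, 0, 1, 0], ![-1, 0, -1, 0],
    ![1, 0, 0, 1], ![1, 0, 0, -1], ![-1, 0, 0, 1], ![-1, 0, 0, -1],
    ![0, 1, 1, 0], ![0, 1, -1, 0], ![0, -1, 1, 0], ![0, -1, -1, 0],
    ![0, 1, 0, 1], ![0, 1, 0, -1], ![0, -1, 0, 1], ![0, -1, 0, -1],
    ![0, 0, 1, 1], ![0, 0, 1, -1], ![0, 0, -1, 1], ![0, 0, -1, -1]]

/-- The 24 positive roots `β₁, …, β₂₄` of `F4` (the simple roots are `β₁, …, β₄`; other values of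
the argument are not used). -/
def root : ℕ → Fin 4 → ℤ
  | 1 => ![-1, -1, -1, 1]
  | 2 => ![0, 0, 2, 0]
  | 3 => ![0, 1, -1, 0]
  | 4 => ![1, -1, 0, 0]
  | 5 => ![-1, -1, 1, 1]
  | 6 => ![0, 1, 1, 0]
  | 7 => ![1, 0, -1, 0]
  | 8 => ![-1, 0, 0, 1]
  | 9 => ![0, 2, 0, 0]
  | 10 => ![1, 0, 1, 0]
  | 11 => ![-1, 1, -1, 1]
  | 12 => ![0, -1, 0, 1]
  | 13 => ![1, 1, 0, 0]
  | 14 => ![-1, 1, 1, 1]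
  | 15 => ![0, 0, -1, 1]
  | 16 => ![2, 0, 0, 0]
  | 17 => ![0, 0, 1, 1]
  | 18 => ![1, -1, -1, 1]
  | 19 => ![0, 1, 0, 1]
  | 20 => ![1, -1, 1, 1]
  | 21 => ![1, 0, 0, 1]
  | 22 => ![1, 1, -1, 1]
  | 23 => ![1, 1, 1, 1]
  | 24 => ![0, 0, 0, 2]
  | _ => 0

/-- The label (`3` or `4`) of the short simple root that belongs to a zero-weight basis vector. -/
def zeroLabel : Fin 2 → ℕ := ![3, 4]

/-- The Chevalley generators `e_k` (`σ = 1`) and `f_k` (`σ = -1`) of the simple roots `β_k`,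
`k = 1, …, 4`, in the quasi-minuscule representation: with `β = σ β_k`,
`v_ν ↦ v_{ν+β}` if `ν + β` is a short root, `v_{-β} ↦ z_k` and `z_j ↦ |(β_j, β_k)| v_β` if `β_k` is
short, and all other basis vectors are annihilated. -/
def simple (k : ℕ) (σ : ℤ) : Matrix Idx Idx ℚ := Matrix.of fun m n =>
  match m, n with
  | .inl μ, .inl ν => if shortRoot μ = shortRoot ν + σ • root k then 1 else 0
  | .inr j, .inl ν => if zeroLabel j = k ∧ shortRoot ν = -(σ • root k) then 1 else 0
  | .inl μ, .inr j =>
      if shortRoot μ = σ • root k then ((|root (zeroLabel j) ⬝ᵥ root k| : ℤ) : ℚ) else 0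
  | .inr _, .inr _ => 0

/-- `[A, B]` for the raising (`σ = 1`) and `[B, A]` for the lowering (`σ = -1`) operators. -/
def comm (A B : ℤ → Matrix Idx Idx ℚ) (σ : ℤ) : Matrix Idx Idx ℚ := (σ : ℚ) • ⁅A σ, B σ⁆

/-! Chevalley-normalised root vectors of `± β_k`, obtained from the simple ones by commutators; the
vector of `-β_k` is the image of that of `β_k` under the anti-automorphism `e_k ↔ f_k`.  A
Cartan-Weyl basis is unique up to signs.  The signs below are, up to the signs of the simple root
vectors, the only ones for which the `spStep` below obey the commutation relations of the standard
step operators of `sp(6)` in 6 dimensions, the `W` below carry the standard `14'` of `sp(6)`, and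
the three matrices `J` below close an `su(2)` (it then commutes with its complement `usp(6)` in the
maximal compact subalgebra). -/

def e1 : ℤ → Matrix Idx Idx ℚ := simple 1
def e2 : ℤ → Matrix Idx Idx ℚ := simple 2
def e3 : ℤ → Matrix Idx Idx ℚ := simple 3
def e4 : ℤ → Matrix Idx Idx ℚ := simple 4
def e5 : ℤ → Matrix Idx Idx ℚ := comm e1 e2
def e6 : ℤ → Matrix Idx Idx ℚ := comm e2 e3
def e7 : ℤ → Matrix Idx Idx ℚ := comm e4 e3
def e8 : ℤ → Matrix Idx Idx ℚ := comm e6 e1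
def e9 : ℤ → Matrix Idx Idx ℚ := fun σ => (1 / 2 : ℚ) • comm e3 e6 σ
def e10 : ℤ → Matrix Idx Idx ℚ := comm e7 e2
def e11 : ℤ → Matrix Idx Idx ℚ := comm e9 e1
def e12 : ℤ → Matrix Idx Idx ℚ := comm e10 e1
def e13 : ℤ → Matrix Idx Idx ℚ := comm e6 e7
def e14 : ℤ → Matrix Idx Idx ℚ := comm e11 e2
def e15 : ℤ → Matrix Idx Idx ℚ := comm e1 e13
def e16 : ℤ → Matrix Idx Idx ℚ := fun σ => (1 / 2 : ℚ) • comm e4 e13 σ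
def e17 : ℤ → Matrix Idx Idx ℚ := comm e2 e15
def e18 : ℤ → Matrix Idx Idx ℚ := comm e16 e1
def e19 : ℤ → Matrix Idx Idx ℚ := comm e17 e3
def e20 : ℤ → Matrix Idx Idx ℚ := comm e18 e2
def e21 : ℤ → Matrix Idx Idx ℚ := comm e4 e19
def e22 : ℤ → Matrix Idx Idx ℚ := comm e18 e9
def e23 : ℤ → Matrix Idx Idx ℚ := comm e2 e22
def e24 : ℤ → Matrix Idx Idx ℚ := comm e23 e1

/-- The Chevalley-normalised root vector of the root `σ β_k`, `σ = ±1`. -/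
def chev : ℕ → ℤ → Matrix Idx Idx ℚ
  | 1 => e1 | 2 => e2 | 3 => e3 | 4 => e4 | 5 => e5 | 6 => e6 | 7 => e7 | 8 => e8
  | 9 => e9 | 10 => e10 | 11 => e11 | 12 => e12 | 13 => e13 | 14 => e14 | 15 => e15 | 16 => e16
  | 17 => e17 | 18 => e18 | 19 => e19 | 20 => e20 | 21 => e21 | 22 => e22 | 23 => e23 | 24 => e24
  | _ => 0

/-- The Cartan generators `ℋ_i`, `i = 1, …, 4`. -/
def cartan (i : Fin 4) : Matrix Idx Idx ℝ :=
  Matrix.diagonal (Sum.elim (fun μ => (shortRoot μ i : ℝ)) 0)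

/-- The step operators `E^{σ β_k}`, `σ = ±1`, in the Cartan-Weyl normalisation
`[E^β, E^{-β}] = β · ℋ`. -/
def E (σ : ℤ) (k : ℕ) : Matrix Idx Idx ℝ :=
  (if root k ⬝ᵥ root k = 4 then √2 else 1 : ℝ) • (chev k σ).map (fun r : ℚ => (r : ℝ))

/-- The compact generators `H_k = E^{β_k} - E^{-β_k}`. -/
def compact (k : ℕ) : Matrix Idx Idx ℝ := E 1 k - E (-1) k

/-- The generators `J^1, J^2, J^3` of the `su(2)` factor of the isotropy algebra
`su(2) ⊕ usp(6)`. -/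
def J : Fin 3 → Matrix Idx Idx ℝ :=
  ![(1 / (4 * √2)) • (compact 1 - compact 14 + compact 20 - compact 22),
    (1 / (4 * √2)) • (compact 5 + compact 11 - compact 18 + compact 23),
    -((1 / (4 * √2)) • (compact 2 - compact 9 + compact 16 + compact 24))]

/-- The Ehlers subalgebra `sl(2)_E`. -/
def L0 : Matrix Idx Idx ℝ := (1 / 2 : ℝ) • cartan 3
def Lplus : Matrix Idx Idx ℝ := (1 / √2) • E 1 24
def Lminus : Matrix Idx Idx ℝ := (1 / √2) • E (-1) 24

/-- The universal compact generator `𝔖 = L_+ - L_-`. -/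
def S : Matrix Idx Idx ℝ := Lplus - Lminus

/-- The step operators `ℰ^{α_i}`, `i = 1, …, 9`, of the positive roots of `sp(6)`. -/
def spStep : ℕ → Matrix Idx Idx ℝ
  | 1 => E 1 4
  | 2 => E 1 3
  | 3 => E 1 2
  | 4 => E 1 7
  | 5 => -E 1 6
  | 6 => E 1 10
  | 7 => -E 1 9
  | 8 => E 1 13
  | 9 => E 1 16
  | _ => 0

/-- The Heisenberg generators `W^{1,α}`, `α = 1, …, 14`. -/
def W : ℕ → Matrix Idx Idx ℝ
  | 1 => E 1 5
  | 2 => E 1 20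
  | 3 => E 1 14
  | 4 => -E 1 23
  | 5 => E 1 21
  | 6 => E 1 19
  | 7 => -E 1 17
  | 8 => -E 1 22
  | 9 => -E 1 11
  | 10 => -E 1 18
  | 11 => -E 1 1
  | 12 => -E 1 8
  | 13 => -E 1 12
  | 14 => -E 1 15
  | _ => 0

/-! ## The quaternionic Kähler manifold `F4(4)/(SU(2) × USp(6))` in solvable coordinates -/

/-- Labels of the 28 solvable coordinates; `h i`, `p i`, `Z i` stand for `h_{i+1}`, `p_{i+1}`,
`Z_{i+1}`. -/
inductive Coord where
  | U : Coord
  | a : Coord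
  | h : Fin 3 → Coord
  | p : Fin 9 → Coord
  | Z : Fin 14 → Coord
  deriving DecidableEq, Fintype

/-- The solvable coset representative: `exp(a L_+) · exp(∑ Z_odd W_odd) · exp(∑ Z_even W_even) ·
exp(p₉ ℰ^{α₉}) ⋯ exp(p₁ ℰ^{α₁}) · exp(h₁ ℋ₁) exp(h₂ ℋ₂) exp(h₃ ℋ₃) · exp(U L_0)`. -/
def coset (q : Coord → ℝ) : Matrix Idx Idx ℝ :=
  NormedSpace.exp (q .a • Lplus)
  * NormedSpace.exp (∑ i : Fin 14 with i.val % 2 = 0, q (.Z i) • W (i + 1))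
  * NormedSpace.exp (∑ i : Fin 14 with i.val % 2 = 1, q (.Z i) • W (i + 1))
  * (List.ofFn fun i : Fin 9 => NormedSpace.exp (q (.p i.rev) • spStep (i.rev + 1))).prod
  * (List.ofFn fun j : Fin 3 => NormedSpace.exp (q (.h j) • cartan j.castSucc)).prod
  * NormedSpace.exp (q .U • L0)

/-- The tri-holomorphic moment map `𝒫^x_t = Tr₂₆ (J^x 𝕃⁻¹ t 𝕃)`. -/
def momentMap (t : Matrix Idx Idx ℝ) (x : Fin 3) (q : Coord → ℝ) : ℝ :=
  (J x * (coset q)⁻¹ * t * coset q).trace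

/-- The squared tri-holomorphic moment map `∑_x (𝒫^x_t)²`. -/
def potential (t : Matrix Idx Idx ℝ) (q : Coord → ℝ) : ℝ := ∑ x, momentMap t x q ^ 2

/-- The Maurer-Cartan form `Ξ = 𝕃⁻¹ d𝕃` at `q`, evaluated on the tangent vector `v`. -/
def maurerCartan (q v : Coord → ℝ) : Matrix Idx Idx ℝ :=
  (coset q)⁻¹ * Matrix.of fun m n => deriv (fun s : ℝ => coset (q + s • v) m n) 0

/-- The invariant metric of the coset manifold in the solvable coordinates.  The Maurer-Cartan form
is `Ξ = ∑ e^i ℋ_i + ∑ e^β E^β` (sum over the positive roots), where the vielbein components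
`e^i = Tr(ℋ_i Ξ)/12` and `e^β = Tr(E^{-β} Ξ)/12` are extracted with the trace form
`Tr(ℋ_i ℋ_j) = 12 δ_ij`, `Tr(E^β E^{-β}) = 12`, and
`ds² = ∑ (e^i)² + ½ ∑ (e^β)² = ¼ dU² + dh₁² + dh₂² + dh₃² + …`, which is `1/12` of the trace of the
square of the non-compact part of `Ξ`. -/
def metric (q v w : Coord → ℝ) : ℝ :=
  ∑ i, ((cartan i * maurerCartan q v).trace / 12) * ((cartan i * maurerCartan q w).trace / 12)
  + (1 / 2) * ∑ k ∈ Finset.Icc 1 24,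
      ((E (-1) k * maurerCartan q v).trace / 12) * ((E (-1) k * maurerCartan q w).trace / 12)

/-! ## Scalar field theories and consistent truncations -/

/-- Partial derivative of `f` in the direction of the `i`-th coordinate. -/
def pd {ι : Type*} [DecidableEq ι] (f : (ι → ℝ) → ℝ) (i : ι) (u : ι → ℝ) : ℝ :=
  deriv (fun s => f (Function.update u i s)) (u i)

/-- `f` has a vanishing partial derivative at `u` in the direction of the `i`-th coordinate. -/
def StationaryAlong {ι : Type*} [DecidableEq ι] (f : (ι → ℝ) → ℝ) (i : ι) (u : ι → ℝ) : Prop :=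
  HasDerivAt (fun s => f (Function.update u i s)) 0 (u i)

/-- Coordinates of the four-dimensional space-time. -/
abbrev Spacetime := Fin 4 → ℝ

/-- A first-order Lagrangian density `ℒ(x, φ, ∂_μ φ)` for scalar fields `φ` labelled by `ι`. -/
abbrev Lagrangian (ι : Type*) := Spacetime → (ι → ℝ) → (Fin 4 → ι → ℝ) → ℝ

/-- The first derivatives `∂_μ φ^I`. -/
def jet {ι : Type*} (φ : Spacetime → ι → ℝ) (x : Spacetime) (μ : Fin 4) (I : ι) : ℝ :=
  pd (fun y => φ y I) μ x

/-- The left-hand side `∂_μ (∂ℒ/∂(∂_μ φ^I)) - ∂ℒ/∂φ^I` of the `I`-th field equation. -/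
def eulerLagrange {ι : Type*} [DecidableEq ι] (ℒ : Lagrangian ι) (φ : Spacetime → ι → ℝ) (I : ι)
    (x : Spacetime) : ℝ :=
  ∑ μ, pd (fun y => pd (fun w : ι → ℝ => ℒ y (φ y) (Function.update (jet φ y) μ w)) I
      (jet φ y μ)) μ x
    - pd (fun u => ℒ x u (jet φ x)) I (φ x)

/-- The pull-back of a Lagrangian along a map `φ = F(ψ)` of field spaces. -/
def pullback {ι κ : Type*} [Fintype κ] [DecidableEq κ] (ℒ : Lagrangian ι)
    (F : (κ → ℝ) → (ι → ℝ)) : Lagrangian κ :=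
  fun x s w => ℒ x (F s) (fun μ I => ∑ k, pd (fun s' => F s' I) k s * w μ k)

/-- `F` is a consistent truncation of the theory with Lagrangian `ℒ`: on every field configuration of
the truncated theory, the pull-back of the full set of field equations is equivalent to the field
equations of the pulled-back Lagrangian. -/
def IsConsistentTruncation {ι κ : Type*} [DecidableEq ι] [Fintype κ] [DecidableEq κ]
    (ℒ : Lagrangian ι) (F : (κ → ℝ) → (ι → ℝ)) : Prop :=
  ∀ ψ : Spacetime → κ → ℝ, ContDiff ℝ 2 ψ → ∀ x : Spacetime,
    (∀ I, eulerLagrange ℒ (fun y => F (ψ y)) I x = 0) ↔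
      ∀ k, eulerLagrange (pullback ℒ F) ψ k x = 0

/-- A smooth pseudo-Riemannian metric on space-time. -/
def IsSpacetimeMetric (γ : Spacetime → Matrix (Fin 4) (Fin 4) ℝ) : Prop :=
  (∀ μ ν, ContDiff ℝ ∞ fun x => γ x μ ν) ∧ ∀ x, (γ x).IsSymm ∧ (γ x).det ≠ 0

/-- The Lagrangian density `√|det γ| (γ^{μν} g(∂_μ φ, ∂_ν φ) - V(φ))` of the sigma model with target
metric `g` and potential `V` in the space-time metric `γ`. -/
def sigmaModel {ι : Type*} (γ : Spacetime → Matrix (Fin 4) (Fin 4) ℝ)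
    (g : (ι → ℝ) → (ι → ℝ) → (ι → ℝ) → ℝ) (V : (ι → ℝ) → ℝ) : Lagrangian ι :=
  fun x u w => √|(γ x).det| * (∑ μ, ∑ ν, (γ x)⁻¹ μ ν * g u (w μ) (w ν) - V u)

/-! ## The gaugings and the truncations -/

/-- The parabolic generators `ℰ^{α₉}, ℰ^{α₇}, ℰ^{α₃}` that go with `β₁, β₂, β₃`. -/
def stuStep : Fin 3 → Matrix Idx Idx ℝ := ![spStep 9, spStep 7, spStep 3]

/-- The generator `t_STU = β₃ ℰ^{α₃} + β₂ ℰ^{α₇} + β₁ ℰ^{α₉} - κ 𝔖`. -/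
def tSTU (β : Fin 3 → ℝ) (κ : ℝ) : Matrix Idx Idx ℝ := ∑ i, β i • stuStep i - κ • S

/-- The three generators `t_U, t_T, t_S` (`i = 0, 1, 2`): `β₁ ℰ^{α₉} - κ₁ 𝔖`, `β₂ ℰ^{α₇} - κ₂ 𝔖`,
`β₃ ℰ^{α₃} - κ₃ 𝔖`. -/
def tSep (β κ : Fin 3 → ℝ) (i : Fin 3) : Matrix Idx Idx ℝ := β i • stuStep i - κ i • S

/-- The potential of the gauging of `t_STU`. -/
def VSTU (β : Fin 3 → ℝ) (κ : ℝ) : (Coord → ℝ) → ℝ := potential (tSTU β κ)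

/-- The potential of the separate gaugings of `t_S, t_T, t_U`. -/
def VSep (β κ : Fin 3 → ℝ) (q : Coord → ℝ) : ℝ := ∑ i, potential (tSep β κ i) q

/-- The locus `Z = U = a = p = 0`, parametrised by the dilatons `h`. -/
def dilatons (h : Fin 3 → ℝ) : Coord → ℝ
  | .h i => h i
  | _ => 0

/-- The number `q` of non-vanishing `β_i`. -/
def active (β : Fin 3 → ℝ) : ℕ := (Finset.univ.filter fun i => β i ≠ 0).card

/-- The one-field locus: `h_i = φ/√(2q) + ½ log|β_i|` (so `h_i = φ/√(2q)` if `|β_i| = 1`) for all `i`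
with `β_i ≠ 0`, the other dilatons constant, and all remaining fields zero. -/
def oneField (β c : Fin 3 → ℝ) (φ : Unit → ℝ) : Coord → ℝ :=
  dilatons fun i => if β i = 0 then c i else φ () / √(2 * active β) + Real.log |β i| / 2

/-- The potential is Starobinsky-like with parameter `α`: up to a constant shift of the canonically
normalised field it is a positive multiple of `(1 - exp(-√(2/(3α)) φ))²`. -/
def IsStarobinskyLike (α : ℝ) (V : ℝ → ℝ) : Prop :=
  ∃ C > 0, ∃ φ₀ : ℝ, ∀ φ, V φ = C * (1 - Real.exp (-√(2 / (3 * α)) * (φ - φ₀))) ^ 2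

end

end MultiStar

/-! Almost everything follows from the weight grading of the 26-dimensional representation. A matrix
that raises weights by `β` (`IsRootVector`) is an eigenvector of the Cartan subalgebra, and the
trace of a product of two such matrices vanishes unless their weights cancel. Explicit matrices are
needed for few facts only: the step operators of sp(6) commute with `E^{±β₂₄}`, the three long ones
commute with each other, and the norms of the long root vectors are fixed by a trace. These are
decided by the kernel on sparse integer matrices.

Geometry. The Cartan factors stand on the right of the coset representative, so the Maurer-Cartan
form along a dilaton is the constant `ℋ_j`. Hence the metric on dilaton velocities is flat at every
point of the coset (`metric_dilatons_dilatons`), and on the dilaton locus the other directions are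
orthogonal to the dilatons (`metric_single_dilatons`). The kinetic term therefore never drives a
field off the locus, and the truncation is consistent once the potential is stationary in all
transverse directions.

Stationarity. Conjugation with the sign `(-1)^{μ_j}` fixes `t_STU`, maps each `J^x` to `±J^x` and
acts on the coordinates by signs, so the potential is even in every odd coordinate. For `j = 3`, the
fourth component, this settles the `Z_m`; it also makes `P¹` and `P²` vanish where `Z = U = a = 0`,
leaving `V = (P³)²`. The derivatives of `P³` along `U` and `a` are traces of `J³` with `L₊ + L₋` and
with a weight-zero matrix, and both vanish. A coordinate `p_r` is either odd under some parity or
belongs to a long root, whose generator commutes with `t_STU`, so that the potential is constant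
along it.

Values. Conjugation with the dilatons replaces `β_i` by `β_i e^{-2h_i}` in `t_STU`, and `P³` is
linear in `t`. The separate gaugings are the case of a single non-zero parameter, summed over three
copies.

One field. What remains is three flat scalars with equations `□h_i ∝ ∂_iV`. The shift `½ log|β_i|`
turns `β_i e^{-2h_i}` into `sign(β_i)` times one common exponential. Under the sign conditions all
active `∂_iV` then coincide, so the active equations are multiples of one equation for `φ`; the
inactive ones hold trivially. The kinetic term comes from `q · (1/√(2q))² = 1/2`. -/

namespace MultiStar

/-! ## Sparse matrices -/

/-- Sparse integer matrices: lists of entries `(row, column, value)`, to be added up. -/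
abbrev Sparse := List (Idx × Idx × ℤ)

namespace Sparse

/-- The rational matrix with the given entries. -/
def toMatrix (l : Sparse) : Matrix Idx Idx ℚ :=
  (l.map fun t => Matrix.single t.1 t.2.1 (t.2.2 : ℚ)).sum

/-- Add one entry, merging it with an entry at the same position. -/
def insert (t : Idx × Idx × ℤ) : Sparse → Sparse
  | [] => [t]
  | s :: l =>
    if t.1 = s.1 ∧ t.2.1 = s.2.1 then
      if t.2.2 + s.2.2 = 0 then l else (s.1, s.2.1, t.2.2 + s.2.2) :: l
    else s :: insert t l

/-- Merge all entries at the same position. -/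
def normalize (l : Sparse) : Sparse := l.foldr insert []

/-- Multiply all entries by `c`. -/
def scale (c : ℤ) (l : Sparse) : Sparse := l.map fun t => (t.1, t.2.1, c * t.2.2)

/-- Divide all entries by two. -/
def half (l : Sparse) : Sparse := l.map fun t => (t.1, t.2.1, t.2.2 / 2)

/-- The matrix product. -/
def mul (A B : Sparse) : Sparse :=
  A.flatMap fun a => (B.filter fun b => a.2.1 = b.1).map fun b => (a.1, b.2.1, a.2.2 * b.2.2)

/-- The matrix commutator. -/
def comm (A B : Sparse) : Sparse := normalize (mul A B ++ scale (-1) (mul B A))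

@[simp] theorem toMatrix_nil : toMatrix [] = 0 := rfl

@[simp] theorem toMatrix_cons (t : Idx × Idx × ℤ) (l : Sparse) :
    toMatrix (t :: l) = Matrix.single t.1 t.2.1 (t.2.2 : ℚ) + toMatrix l := by
  simp [toMatrix]

theorem toMatrix_append (A B : Sparse) : toMatrix (A ++ B) = toMatrix A + toMatrix B := by
  simp [toMatrix]

theorem toMatrix_insert (t : Idx × Idx × ℤ) (l : Sparse) :
    toMatrix (insert t l) = Matrix.single t.1 t.2.1 (t.2.2 : ℚ) + toMatrix l := by
  induction l with
  | nil => simp [insert]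
  | cons s l ih =>
    unfold insert
    split_ifs with h h'
    · rw [toMatrix_cons, h.1, h.2, ← add_assoc, ← Matrix.single_add]
      have h0 : (t.2.2 : ℚ) + s.2.2 = 0 := by exact_mod_cast h'
      simp [h0]
    · rw [toMatrix_cons, toMatrix_cons, h.1, h.2, ← add_assoc, ← Matrix.single_add]
      simp
    · rw [toMatrix_cons, toMatrix_cons, ih, add_left_comm]

theorem toMatrix_normalize (l : Sparse) : toMatrix (normalize l) = toMatrix l := by
  induction l with
  | nil => rfl
  | cons t l ih =>
    rw [toMatrix_cons, ← ih]
    exact toMatrix_insert t _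

theorem toMatrix_scale (c : ℤ) (l : Sparse) : toMatrix (scale c l) = (c : ℚ) • toMatrix l := by
  induction l with
  | nil => simp [scale]
  | cons t l ih =>
    have : scale c (t :: l) = (t.1, t.2.1, c * t.2.2) :: scale c l := rfl
    rw [this, toMatrix_cons, toMatrix_cons, ih, smul_add, Matrix.smul_single]
    simp

theorem toMatrix_map_mul (a : Idx × Idx × ℤ) (B : Sparse) :
    toMatrix ((B.filter fun b => a.2.1 = b.1).map fun b => (a.1, b.2.1, a.2.2 * b.2.2))
      = Matrix.single a.1 a.2.1 (a.2.2 : ℚ) * toMatrix B := by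
  induction B with
  | nil => simp
  | cons b B ih =>
    rw [toMatrix_cons, mul_add, ← ih]
    by_cases h : a.2.1 = b.1
    · simp [h]
    · simp [h, Matrix.single_mul_single_of_ne]

theorem toMatrix_mul (A B : Sparse) : toMatrix (mul A B) = toMatrix A * toMatrix B := by
  induction A with
  | nil => simp [mul]
  | cons a A ih =>
    have : mul (a :: A) B = ((B.filter fun b => a.2.1 = b.1).map
      fun b => (a.1, b.2.1, a.2.2 * b.2.2)) ++ mul A B := by simp [mul]
    rw [this, toMatrix_append, toMatrix_map_mul, ih, toMatrix_cons, add_mul]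

theorem toMatrix_comm (A B : Sparse) : toMatrix (comm A B) = ⁅toMatrix A, toMatrix B⁆ := by
  rw [comm, toMatrix_normalize, toMatrix_append, toMatrix_scale, toMatrix_mul, toMatrix_mul,
    Ring.lie_def]
  simp [sub_eq_add_neg]

/-- Integer division is exact only on even entries. The hypothesis states just that, in a form that
can be decided by evaluation. -/
theorem toMatrix_half {l : Sparse} (h : scale 2 (half l) = l) :
    toMatrix (half l) = (1 / 2 : ℚ) • toMatrix l := by
  conv_rhs => rw [← h, toMatrix_scale, smul_smul]
  norm_num

/-- The trace of the matrix product. -/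
def traceMul (A B : Sparse) : ℤ :=
  ((mul A B).map fun t => if t.1 = t.2.1 then t.2.2 else 0).sum

theorem trace_toMatrix (l : Sparse) :
    (toMatrix l).trace = ((l.map fun t => if t.1 = t.2.1 then t.2.2 else 0).sum : ℤ) := by
  induction l with
  | nil => simp
  | cons t l ih =>
    rw [toMatrix_cons, Matrix.trace_add, ih]
    by_cases h : t.1 = t.2.1
    · simp [h]
    · simp [h, Matrix.trace_single_eq_of_ne]

theorem trace_toMatrix_mul (A B : Sparse) :
    (toMatrix A * toMatrix B).trace = traceMul A B := by
  rw [← toMatrix_mul, trace_toMatrix, traceMul]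

end Sparse

/-! ### Sparse Chevalley generators and the finite checks -/

/-- The integer matrix whose entries at the positions `(i, j)` of a list are `1`; positions are
numbered from `0` to `25`. -/
def Sparse.ofPositions (l : List (Fin 26 × Fin 26)) : Sparse :=
  l.map fun t => (finSumFinEquiv.symm t.1, finSumFinEquiv.symm t.2, 1)

/-- Sparse forms of the Chevalley generators of the simple roots. -/
def simpleSparse : ℕ → ℤ → Sparse
  | 1, 1 => .ofPositions [(22, 0), (18, 4), (15, 9), (10, 12), (7, 17), (3, 21)]
  | 1, _ => .ofPositions [(21, 3), (17, 7), (12, 10), (9, 15), (4, 18), (0, 22)]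
  | 2, 1 => .ofPositions [(4, 5), (6, 7), (12, 13), (14, 15), (20, 22), (21, 23)]
  | 2, _ => .ofPositions [(5, 4), (7, 6), (13, 12), (15, 14), (22, 20), (23, 21)]
  -- Repeated positions add up: `(13, 24)` occurs twice because `z_3 ↦ |(β₃, β₃)| v_{β₃}` with `(β₃,
  -- β₃) = 2`. The positions 24 and 25 are `z_3` and `z_4`.
  | 3, 1 => .ofPositions [(5, 1), (7, 3), (0, 4), (2, 6), (24, 14), (22, 18), (23, 19), (16, 20),
      (17, 21), (13, 24), (13, 24), (13, 25)]
  | 3, _ => .ofPositions [(4, 0), (6, 2), (1, 5), (3, 7), (24, 13), (20, 16), (21, 17), (18, 22),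
      (19, 23), (14, 24), (14, 24), (14, 25)]
  | 4, 1 => .ofPositions [(25, 2), (14, 6), (15, 7), (18, 10), (19, 11), (4, 12), (5, 13), (8, 16),
      (9, 17), (1, 24), (1, 25), (1, 25)]
  | 4, _ => .ofPositions [(25, 1), (12, 4), (13, 5), (16, 8), (17, 9), (6, 14), (7, 15), (10, 18),
      (11, 19), (2, 24), (2, 25), (2, 25)]
  | _, _ => []

theorem simple_eq_toMatrix : ∀ k ∈ ({1, 2, 3, 4} : Finset ℕ), ∀ σ ∈ ({1, -1} : Finset ℤ),
    simple k σ = (simpleSparse k σ).toMatrix := by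
  decide +kernel

/-- Commutators of families of sparse matrices, cf. `MultiStar.comm`. -/
def Sparse.commFamily (A B : ℤ → Sparse) (σ : ℤ) : Sparse :=
  Sparse.scale σ (Sparse.comm (A σ) (B σ))

/-! Sparse forms of the Chevalley generators. -/

def s6 : ℤ → Sparse := .commFamily (simpleSparse 2) (simpleSparse 3)
def s7 : ℤ → Sparse := .commFamily (simpleSparse 4) (simpleSparse 3)
def s9 : ℤ → Sparse := fun σ => .half (.commFamily (simpleSparse 3) s6 σ)
def s10 : ℤ → Sparse := .commFamily s7 (simpleSparse 2)
def s13 : ℤ → Sparse := .commFamily s6 s7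
def s16 : ℤ → Sparse := fun σ => .half (.commFamily (simpleSparse 4) s13 σ)
def s18 : ℤ → Sparse := .commFamily s16 (simpleSparse 1)
def s22 : ℤ → Sparse := .commFamily s18 s9
def s23 : ℤ → Sparse := .commFamily (simpleSparse 2) s22
def s24 : ℤ → Sparse := .commFamily s23 (simpleSparse 1)

/-- The sparse forms of those `chev k` that are needed in explicit form. -/
def chevSparse : ℕ → ℤ → Sparse
  | 2 => simpleSparse 2 | 3 => simpleSparse 3 | 4 => simpleSparse 4 | 6 => s6 | 7 => s7
  | 9 => s9 | 10 => s10 | 13 => s13 | 16 => s16 | 24 => s24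
  | _ => fun _ => []

theorem comm_eq_toMatrix {A B : ℤ → Matrix Idx Idx ℚ} {a b : ℤ → Sparse} {σ : ℤ}
    (hA : A σ = (a σ).toMatrix) (hB : B σ = (b σ).toMatrix) :
    comm A B σ = (Sparse.commFamily a b σ).toMatrix := by
  rw [comm, hA, hB, Sparse.commFamily, Sparse.toMatrix_scale, Sparse.toMatrix_comm]

theorem half_comm_eq_toMatrix {A B : ℤ → Matrix Idx Idx ℚ} {a b : ℤ → Sparse} {σ : ℤ}
    (hA : A σ = (a σ).toMatrix) (hB : B σ = (b σ).toMatrix)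
    (h : (Sparse.commFamily a b σ).half.scale 2 = Sparse.commFamily a b σ) :
    (1 / 2 : ℚ) • comm A B σ = (Sparse.commFamily a b σ).half.toMatrix := by
  rw [comm_eq_toMatrix hA hB, Sparse.toMatrix_half h]

/-- The positive roots of `sp(6)`. -/
def spRoots : List ℕ := [4, 3, 2, 7, 6, 10, 9, 13, 16]

theorem chev_eq_toMatrix {σ : ℤ} (hσ : σ ∈ ({1, -1} : Finset ℤ)) :
    ∀ k ∈ 24 :: spRoots, chev k σ = (chevSparse k σ).toMatrix := by
  -- `β₆ - β₃` is a root and `β₆ - 2β₃` is not, so the structure constant of `[e₃, e₆]` is `±2` and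
  -- the commutator has even entries. The same happens for `β₄` and `β₁₃`.
  have half9 : ∀ σ ∈ ({1, -1} : Finset ℤ),
      (Sparse.commFamily (simpleSparse 3) s6 σ).half.scale 2
        = Sparse.commFamily (simpleSparse 3) s6 σ := by decide +kernel
  have half16 : ∀ σ ∈ ({1, -1} : Finset ℤ),
      (Sparse.commFamily (simpleSparse 4) s13 σ).half.scale 2
        = Sparse.commFamily (simpleSparse 4) s13 σ := by decide +kernel
  have h1 : e1 σ = _ := simple_eq_toMatrix 1 (by decide) σ hσ
  have h2 : e2 σ = _ := simple_eq_toMatrix 2 (by decide) σ hσ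
  have h3 : e3 σ = _ := simple_eq_toMatrix 3 (by decide) σ hσ
  have h4 : e4 σ = _ := simple_eq_toMatrix 4 (by decide) σ hσ
  have h6 : e6 σ = (s6 σ).toMatrix := comm_eq_toMatrix h2 h3
  have h7 : e7 σ = (s7 σ).toMatrix := comm_eq_toMatrix h4 h3
  have h9 : e9 σ = (s9 σ).toMatrix := half_comm_eq_toMatrix h3 h6 (half9 σ hσ)
  have h10 : e10 σ = (s10 σ).toMatrix := comm_eq_toMatrix h7 h2
  have h13 : e13 σ = (s13 σ).toMatrix := comm_eq_toMatrix h6 h7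
  have h16 : e16 σ = (s16 σ).toMatrix := half_comm_eq_toMatrix h4 h13 (half16 σ hσ)
  have h18 : e18 σ = (s18 σ).toMatrix := comm_eq_toMatrix h16 h1
  have h22 : e22 σ = (s22 σ).toMatrix := comm_eq_toMatrix h18 h9
  have h23 : e23 σ = (s23 σ).toMatrix := comm_eq_toMatrix h2 h22
  have h24 : e24 σ = (s24 σ).toMatrix := comm_eq_toMatrix h23 h1
  simp only [spRoots, List.forall_mem_cons, List.not_mem_nil, IsEmpty.forall_iff, implies_true,
    and_true]
  exact ⟨h24, h4, h3, h2, h7, h6, h10, h9, h13, h16⟩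

/-- `normalize` removes entries that cancel, so a vanishing commutator can be recognised as the
empty list, without comparing matrices entry by entry. -/
theorem commute_of_sparse_comm {a b : Sparse} (h : Sparse.comm a b = []) :
    Commute a.toMatrix b.toMatrix := by
  have := Sparse.toMatrix_comm a b
  rw [h, Sparse.toMatrix_nil, Ring.lie_def] at this
  exact (sub_eq_zero.1 this.symm)

/-- No `β_k ± β₂₄` is a root, since sp(6) centralises the Ehlers sl(2). Weights alone do not
suffice: `β_k ± β₂₄` may still be a difference of two weights of the 26, so the commutator is
computed. -/
theorem commute_chev_highest : ∀ k ∈ spRoots, ∀ σ ∈ ({1, -1} : Finset ℤ),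
    Commute (chev k 1) (chev 24 σ) := by
  have key : ∀ k ∈ spRoots, ∀ σ ∈ ({1, -1} : Finset ℤ),
      Sparse.comm (chevSparse k 1) (chevSparse 24 σ) = [] := by decide +kernel
  intro k hk σ hσ
  rw [chev_eq_toMatrix (by decide) k (List.mem_cons_of_mem _ hk),
    chev_eq_toMatrix hσ 24 List.mem_cons_self]
  exact commute_of_sparse_comm (key k hk σ hσ)

/-- The long roots `2ε_i` are strongly orthogonal. As before, their sums are differences of weights,
so a computation is needed. -/
theorem commute_chev_long : ∀ j ∈ [2, 9, 16], ∀ k ∈ [2, 9, 16],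
    Commute (chev j 1) (chev k 1) := by
  have key : ∀ j ∈ [2, 9, 16], ∀ k ∈ [2, 9, 16],
      Sparse.comm (chevSparse j 1) (chevSparse k 1) = [] := by decide +kernel
  have sub : ∀ k ∈ [2, 9, 16], k ∈ 24 :: spRoots := by decide
  intro j hj k hk
  rw [chev_eq_toMatrix (by decide) j (sub j hj), chev_eq_toMatrix (by decide) k (sub k hk)]
  exact commute_of_sparse_comm (key j hj k hk)

/-- Under the sl(2) of a long root the 26 splits into six doublets and fourteen singlets, and each
doublet contributes 1. The two factors `√2` in `E` later turn 6 into 12. -/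
theorem trace_chev_mul_chev : ∀ k ∈ [2, 9, 16, 24], (chev k (-1) * chev k 1).trace = 6 := by
  have key : ∀ k ∈ [2, 9, 16, 24],
      Sparse.traceMul (chevSparse k (-1)) (chevSparse k 1) = 6 := by decide +kernel
  have sub : ∀ k ∈ [2, 9, 16, 24], k ∈ 24 :: spRoots := by decide
  intro k hk
  rw [chev_eq_toMatrix (by decide) k (sub k hk), chev_eq_toMatrix (by decide) k (sub k hk),
    Sparse.trace_toMatrix_mul, key k hk]
  norm_num

/-! ## Root vectors -/

/-- The weights of the basis vectors. -/
def weight : Idx → Fin 4 → ℤ := Sum.elim shortRoot 0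

/-- `M` raises the weight by `β`. -/
def IsRootVector {R : Type*} [Zero R] (M : Matrix Idx Idx R) (β : Fin 4 → ℤ) : Prop :=
  ∀ m n, M m n ≠ 0 → weight m = weight n + β

namespace IsRootVector

variable {R : Type*} [CommRing R] {M N : Matrix Idx Idx R} {α β : Fin 4 → ℤ}

theorem sub (hM : IsRootVector M β) (hN : IsRootVector N β) : IsRootVector (M - N) β := by
  intro m n h
  by_cases h0 : M m n = 0
  · exact hN m n fun h1 => h (by simp [h0, h1])
  · exact hM m n h0

theorem smul (c : R) (hM : IsRootVector M β) : IsRootVector (c • M) β := fun m n h =>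
  hM m n fun h0 => h (by simp [h0])

theorem neg (hM : IsRootVector M β) : IsRootVector (-M) β := fun m n h =>
  hM m n fun h0 => h (by simp [h0])

theorem mul (hM : IsRootVector M α) (hN : IsRootVector N β) : IsRootVector (M * N) (α + β) := by
  intro m n h
  rw [Matrix.mul_apply] at h
  obtain ⟨k, -, hk⟩ := Finset.exists_ne_zero_of_sum_ne_zero h
  rw [hM m k (left_ne_zero_of_mul hk), hN k n (right_ne_zero_of_mul hk), add_assoc, add_comm β]

theorem lie (hM : IsRootVector M α) (hN : IsRootVector N β) : IsRootVector ⁅M, N⁆ (α + β) := by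
  rw [Ring.lie_def]
  exact (hM.mul hN).sub (add_comm β α ▸ hN.mul hM)

theorem trace_eq_zero (hM : IsRootVector M β) (hβ : β ≠ 0) : M.trace = 0 :=
  Finset.sum_eq_zero fun m _ => by
    by_contra h
    exact hβ (by simpa using hM m m h)

/-- This is the orthogonality of root spaces under the trace form; it replaces all evaluation of
mixed traces. -/
theorem trace_mul_eq_zero (hM : IsRootVector M α) (hN : IsRootVector N β) (h : α + β ≠ 0) :
    (M * N).trace = 0 :=
  (hM.mul hN).trace_eq_zero h

theorem diagonal (d : Idx → R) : IsRootVector (Matrix.diagonal d) 0 := fun m n h => by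
  rcases eq_or_ne m n with rfl | hmn
  · simp
  · simp [hmn] at h

end IsRootVector

theorem isRootVector_simple (k : ℕ) (σ : ℤ) :
    IsRootVector (simple k σ) (σ • root k) := by
  rintro (μ | j) (ν | j') h <;> simp only [simple, Matrix.of_apply] at h
  · simpa [weight] using (ite_ne_right_iff.1 h).1
  · simpa [weight] using (ite_ne_right_iff.1 h).1
  · have := (ite_ne_right_iff.1 h).1.2
    simp [weight, this]
  · exact absurd rfl h

theorem IsRootVector.comm {A B : ℤ → Matrix Idx Idx ℚ} {α β γ : Fin 4 → ℤ} {σ : ℤ}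
    (hA : IsRootVector (A σ) (σ • α)) (hB : IsRootVector (B σ) (σ • β)) (h : α + β = γ) :
    IsRootVector (MultiStar.comm A B σ) (σ • γ) := by
  rw [← h, smul_add]
  exact (hA.lie hB).smul _

/-- Weights add under commutators, so the recursion that defines the root vectors also determines
their weights, without evaluating a matrix. -/
theorem isRootVector_chev (k : ℕ) (σ : ℤ) : IsRootVector (chev k σ) (σ • root k) := by
  have h1 : IsRootVector (e1 σ) (σ • root 1) := isRootVector_simple _ σ
  have h2 : IsRootVector (e2 σ) (σ • root 2) := isRootVector_simple _ σ
  have h3 : IsRootVector (e3 σ) (σ • root 3) := isRootVector_simple _ σ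
  have h4 : IsRootVector (e4 σ) (σ • root 4) := isRootVector_simple _ σ
  have h5 : IsRootVector (e5 σ) (σ • root 5) := h1.comm h2 (by decide)
  have h6 : IsRootVector (e6 σ) (σ • root 6) := h2.comm h3 (by decide)
  have h7 : IsRootVector (e7 σ) (σ • root 7) := h4.comm h3 (by decide)
  have h8 : IsRootVector (e8 σ) (σ • root 8) := h6.comm h1 (by decide)
  have h9 : IsRootVector (e9 σ) (σ • root 9) := (h3.comm h6 (by decide)).smul _
  have h10 : IsRootVector (e10 σ) (σ • root 10) := h7.comm h2 (by decide)
  have h11 : IsRootVector (e11 σ) (σ • root 11) := h9.comm h1 (by decide)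
  have h12 : IsRootVector (e12 σ) (σ • root 12) := h10.comm h1 (by decide)
  have h13 : IsRootVector (e13 σ) (σ • root 13) := h6.comm h7 (by decide)
  have h14 : IsRootVector (e14 σ) (σ • root 14) := h11.comm h2 (by decide)
  have h15 : IsRootVector (e15 σ) (σ • root 15) := h1.comm h13 (by decide)
  have h16 : IsRootVector (e16 σ) (σ • root 16) := (h4.comm h13 (by decide)).smul _
  have h17 : IsRootVector (e17 σ) (σ • root 17) := h2.comm h15 (by decide)
  have h18 : IsRootVector (e18 σ) (σ • root 18) := h16.comm h1 (by decide)
  have h19 : IsRootVector (e19 σ) (σ • root 19) := h17.comm h3 (by decide)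
  have h20 : IsRootVector (e20 σ) (σ • root 20) := h18.comm h2 (by decide)
  have h21 : IsRootVector (e21 σ) (σ • root 21) := h4.comm h19 (by decide)
  have h22 : IsRootVector (e22 σ) (σ • root 22) := h18.comm h9 (by decide)
  have h23 : IsRootVector (e23 σ) (σ • root 23) := h2.comm h22 (by decide)
  have h24 : IsRootVector (e24 σ) (σ • root 24) := h23.comm h1 (by decide)
  have h0 : IsRootVector (0 : Matrix Idx Idx ℚ) (σ • 0) := fun m n h => absurd rfl h
  match k with
  | 0 => exact h0
  | 1 => exact h1
  | 2 => exact h2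
  | 3 => exact h3
  | 4 => exact h4
  | 5 => exact h5
  | 6 => exact h6
  | 7 => exact h7
  | 8 => exact h8
  | 9 => exact h9
  | 10 => exact h10
  | 11 => exact h11
  | 12 => exact h12
  | 13 => exact h13
  | 14 => exact h14
  | 15 => exact h15
  | 16 => exact h16
  | 17 => exact h17
  | 18 => exact h18
  | 19 => exact h19
  | 20 => exact h20
  | 21 => exact h21
  | 22 => exact h22
  | 23 => exact h23
  | 24 => exact h24
  | _ + 25 => exact h0

/-! ## The step operators -/

theorem isRootVector_E (σ : ℤ) (k : ℕ) : IsRootVector (E σ k) (σ • root k) :=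
  IsRootVector.smul _ fun m n h => isRootVector_chev k σ m n fun h0 => h (by simp [h0])

theorem commute_E {σ τ : ℤ} {j k : ℕ} (h : Commute (chev j σ) (chev k τ)) :
    Commute (E σ j) (E τ k) :=
  ((h.map (Rat.castHom ℝ).mapMatrix).smul_left _).smul_right _

theorem commute_E_highest {k : ℕ} (hk : k ∈ spRoots) {σ : ℤ} (hσ : σ ∈ ({1, -1} : Finset ℤ)) :
    Commute (E 1 k) (E σ 24) :=
  commute_E (commute_chev_highest k hk σ hσ)

theorem commute_E_long {j k : ℕ} (hj : j ∈ [2, 9, 16]) (hk : k ∈ [2, 9, 16]) :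
    Commute (E 1 j) (E 1 k) :=
  commute_E (commute_chev_long j hj k hk)

theorem trace_E_mul_E {k : ℕ} (hk : k ∈ [2, 9, 16, 24]) : (E (-1) k * E 1 k).trace = 12 := by
  have hroot : ∀ k ∈ [2, 9, 16, 24], root k ⬝ᵥ root k = 4 := by decide
  have h := AddMonoidHom.map_trace (Rat.castHom ℝ) (chev k (-1) * chev k 1)
  rw [trace_chev_mul_chev k hk, Matrix.map_mul] at h
  have h2 : E (-1) k * E 1 k = (2 : ℝ) • ((chev k (-1)).map (Rat.castHom ℝ)
      * (chev k 1).map (Rat.castHom ℝ)) := by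
    rw [E, E, if_pos (hroot k hk), Matrix.smul_mul, Matrix.mul_smul, smul_smul,
      Real.mul_self_sqrt (by norm_num)]
    rfl
  rw [h2, Matrix.trace_smul, ← h]
  norm_num

theorem trace_E_mul_E_of_ne {σ τ : ℤ} {j k : ℕ} (h : σ • root j + τ • root k ≠ 0) :
    (E σ j * E τ k).trace = 0 :=
  (isRootVector_E σ j).trace_mul_eq_zero (isRootVector_E τ k) h

/-! ## The generators that go with the coordinates -/

/-- The numbers of the roots of `ℰ^{α_i}`. -/
def spIndex : Fin 9 → ℕ := ![4, 3, 2, 7, 6, 10, 9, 13, 16]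

/-- The numbers of the roots of `W_m`. -/
def heisenbergIndex : Fin 14 → ℕ := ![5, 20, 14, 23, 21, 19, 17, 22, 11, 18, 1, 8, 12, 15]

/-- The weight of the generator that goes with a coordinate. -/
def coordRoot : Coord → Fin 4 → ℤ
  | .U => 0
  | .a => root 24
  | .h _ => 0
  | .p r => root (spIndex r)
  | .Z m => root (heisenbergIndex m)

/-- The generator that goes with a coordinate. -/
noncomputable def coordGen : Coord → Matrix Idx Idx ℝ
  | .U => L0
  | .a => Lplus
  | .h j => cartan j.castSucc
  | .p r => spStep (r + 1)
  | .Z m => W (m + 1)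

theorem cartan_eq (i : Fin 4) : cartan i = Matrix.diagonal fun m => (weight m i : ℝ) := by
  unfold cartan weight
  congr 1
  ext (m | m) <;> simp

theorem isRootVector_cartan (i : Fin 4) : IsRootVector (cartan i) 0 := .diagonal _

theorem isRootVector_E_one (k : ℕ) : IsRootVector (E 1 k) (root k) := by
  simpa using isRootVector_E 1 k

theorem isRootVector_E_neg_one (k : ℕ) : IsRootVector (E (-1) k) (-root k) := by
  simpa using isRootVector_E (-1) k

theorem isRootVector_coordGen (c : Coord) : IsRootVector (coordGen c) (coordRoot c) := by
  have h := isRootVector_E_one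
  match c with
  | .U => exact (isRootVector_cartan 3).smul _
  | .a => exact (h 24).smul _
  | .h j => exact isRootVector_cartan _
  | .p r =>
    fin_cases r
    exacts [h 4, h 3, h 2, h 7, (h 6).neg, h 10, (h 9).neg, h 13, h 16]
  | .Z m =>
    fin_cases m
    exacts [h 5, h 20, h 14, (h 23).neg, h 21, h 19, (h 17).neg, (h 22).neg, (h 11).neg,
      (h 18).neg, (h 1).neg, (h 8).neg, (h 12).neg, (h 15).neg]

theorem trace_cartan_mul_cartan (i j : Fin 4) :
    (cartan i * cartan j).trace = if i = j then 12 else 0 := by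
  have key : ∀ i j : Fin 4, ∑ m, weight m i * weight m j = if i = j then 12 else 0 := by
    decide +kernel
  have h := congrArg (Int.cast (R := ℝ)) (key i j)
  rw [cartan_eq, cartan_eq, Matrix.diagonal_mul_diagonal, Matrix.trace_diagonal]
  push_cast at h
  exact h

theorem cartan_commute_diagonal (i : Fin 4) (d : Idx → ℝ) :
    Commute (cartan i) (Matrix.diagonal d) := by
  rw [cartan, Commute, SemiconjBy, Matrix.diagonal_mul_diagonal, Matrix.diagonal_mul_diagonal]
  congr 1
  ext m
  exact mul_comm _ _

/-- A root vector is an eigenvector of the adjoint action of the Cartan subalgebra. -/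
theorem IsRootVector.cartan_mul {M : Matrix Idx Idx ℝ} {β : Fin 4 → ℤ} (hM : IsRootVector M β)
    (i : Fin 4) : cartan i * M = M * cartan i + (β i : ℝ) • M := by
  ext m n
  rw [cartan_eq, Matrix.add_apply, Matrix.diagonal_mul, Matrix.mul_diagonal, Matrix.smul_apply]
  by_cases h : M m n = 0
  · simp [h]
  · rw [hM m n h]
    simp only [Pi.add_apply, Int.cast_add, smul_eq_mul]
    ring

theorem IsRootVector.commute_cartan {M : Matrix Idx Idx ℝ} {β : Fin 4 → ℤ} (hM : IsRootVector M β)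
    {i : Fin 4} (h : β i = 0) : Commute (cartan i) M := by
  have := hM.cartan_mul i
  rwa [h, Int.cast_zero, zero_smul, add_zero] at this

/-! ## Parities -/

/-- The sign `(-1)^{μ_j}` on the weight spaces. -/
noncomputable def parity (j : Fin 4) : Matrix Idx Idx ℝ :=
  Matrix.diagonal fun m => (-1 : ℝ) ^ weight m j

theorem parity_mul_self (j : Fin 4) : parity j * parity j = 1 := by
  rw [parity, Matrix.diagonal_mul_diagonal, ← Matrix.diagonal_one]
  congr 1
  ext m
  rw [← mul_zpow]
  norm_num

/-- Conjugation with the sign `(-1)^{μ_j}`. -/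
noncomputable def parityConj (j : Fin 4) : Matrix Idx Idx ℝ →ₐ[ℝ] Matrix Idx Idx ℝ where
  toFun M := parity j * M * parity j
  map_one' := by rw [mul_one, parity_mul_self]
  map_mul' M N := by
    have : parity j * M * parity j * (parity j * N * parity j)
        = parity j * M * (parity j * parity j) * N * parity j := by simp only [mul_assoc]
    rw [this, parity_mul_self, mul_one, mul_assoc (parity j) M N]
  map_zero' := by simp
  map_add' M N := by rw [mul_add, add_mul]
  commutes' r := by
    rw [← Algebra.commutes r (parity j), mul_assoc, parity_mul_self, mul_one]

theorem parityConj_apply (j : Fin 4) (M : Matrix Idx Idx ℝ) :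
    parityConj j M = parity j * M * parity j := rfl

theorem IsRootVector.parityConj {M : Matrix Idx Idx ℝ} {β : Fin 4 → ℤ} (hM : IsRootVector M β)
    (j : Fin 4) : parityConj j M = (-1 : ℝ) ^ β j • M := by
  ext m n
  rw [parityConj_apply, parity, Matrix.mul_diagonal, Matrix.diagonal_mul, Matrix.smul_apply]
  by_cases h : M m n = 0
  · simp [h]
  · have h1 : (-1 : ℝ) ≠ 0 := by norm_num
    have h2 : (-1 : ℝ) ^ weight n j * (-1 : ℝ) ^ weight n j = 1 := by
      rw [← mul_zpow]; norm_num
    rw [hM m n h, Pi.add_apply, zpow_add₀ h1, smul_eq_mul]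
    linear_combination ((-1 : ℝ) ^ β j * M m n) * h2

theorem trace_parityConj (j : Fin 4) (M : Matrix Idx Idx ℝ) :
    (parityConj j M).trace = M.trace := by
  rw [parityConj_apply, Matrix.trace_mul_comm, ← mul_assoc, parity_mul_self, one_mul]

/-- A continuous algebra homomorphism commutes with the exponential, so the conjugation passes
through every factor of the coset representative. -/
theorem parityConj_exp (j : Fin 4) (M : Matrix Idx Idx ℝ) :
    parityConj j (NormedSpace.exp M) = NormedSpace.exp (parityConj j M) := by
  have hc : Continuous fun M : Matrix Idx Idx ℝ => parity j * M * parity j := by fun_prop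
  open scoped Matrix.Norms.Operator in
  exact NormedSpace.map_exp (parityConj j) hc M

/-! ## The coset representative -/

/-- The coset representative without the factors of the Cartan generators. -/
noncomputable def unipotent (q : Coord → ℝ) : Matrix Idx Idx ℝ :=
  NormedSpace.exp (q .a • Lplus)
  * NormedSpace.exp (∑ i : Fin 14 with i.val % 2 = 0, q (.Z i) • W (i + 1))
  * NormedSpace.exp (∑ i : Fin 14 with i.val % 2 = 1, q (.Z i) • W (i + 1))
  * (List.ofFn fun i : Fin 9 => NormedSpace.exp (q (.p i.rev) • spStep (i.rev + 1))).prod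

/-- The factor of the coset representative in the Cartan subgroup. -/
noncomputable def cartanPart (q : Coord → ℝ) : Matrix Idx Idx ℝ :=
  Matrix.diagonal fun m => Real.exp (∑ j : Fin 3, q (.h j) * weight m j.castSucc
    + q .U * (weight m 3 / 2))

theorem exp_smul_cartan (s : ℝ) (i : Fin 4) :
    NormedSpace.exp (s • cartan i) = Matrix.diagonal fun m => Real.exp (s * weight m i) := by
  rw [cartan_eq, ← Matrix.diagonal_smul, Matrix.exp_diagonal]
  congr 1
  ext m
  rw [Pi.coe_exp, ← Real.exp_eq_exp_ℝ]
  rfl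

theorem coset_eq (q : Coord → ℝ) : coset q = unipotent q * cartanPart q := by
  have h : (List.ofFn fun j : Fin 3 => NormedSpace.exp (q (.h j) • cartan j.castSucc)).prod
      * NormedSpace.exp (q .U • L0) = cartanPart q := by
    rw [L0, smul_smul, exp_smul_cartan]
    simp only [exp_smul_cartan, List.ofFn_succ, List.ofFn_zero, List.prod_cons, List.prod_nil,
      mul_one, Matrix.diagonal_mul_diagonal, ← Real.exp_add, cartanPart, Fin.sum_univ_three]
    congr 1
    ext m
    congr 1
    change q (.h 0) * _ + (q (.h 1) * _ + q (.h 2) * _) + q .U * (1 / 2) * _ = _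
    ring_nf
    rfl
  rw [coset, mul_assoc _ (List.prod _) (NormedSpace.exp _), h, unipotent]

theorem isUnit_list_prod {M : Type*} [Monoid M] {l : List M} (h : ∀ x ∈ l, IsUnit x) :
    IsUnit l.prod := by
  induction l with
  | nil => exact isUnit_one
  | cons a l ih =>
    rw [List.prod_cons]
    exact (h a List.mem_cons_self).mul (ih fun x hx => h x (List.mem_cons_of_mem _ hx))

theorem isUnit_coset (q : Coord → ℝ) : IsUnit (coset q) := by
  have h (M : Matrix Idx Idx ℝ) : IsUnit (NormedSpace.exp M) := Matrix.isUnit_exp M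
  refine ((((((h _).mul (h _)).mul (h _)).mul ?_).mul ?_).mul (h _)) <;>
  · refine isUnit_list_prod fun x hx => ?_
    obtain ⟨i, rfl⟩ := List.mem_ofFn.1 hx
    exact h _

theorem isUnit_det_coset (q : Coord → ℝ) : IsUnit (coset q).det :=
  (Matrix.isUnit_iff_isUnit_det _).1 (isUnit_coset q)

/-- The action of the sign `(-1)^{μ_j}` on the coordinates. -/
noncomputable def reflect (j : Fin 4) (q : Coord → ℝ) : Coord → ℝ := fun c =>
  (-1) ^ coordRoot c j * q c

/-- Every exponent is a linear combination of root vectors with the coordinates as coefficients.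
Conjugation multiplies each root vector by a sign, which can be moved onto its coordinate. -/
theorem coset_reflect (j : Fin 4) (q : Coord → ℝ) :
    coset (reflect j q) = parityConj j (coset q) := by
  have h (c : Coord) : q c • parityConj j (coordGen c) = reflect j q c • coordGen c := by
    rw [(isRootVector_coordGen c).parityConj, smul_smul, reflect, mul_comm]
  have hU := h .U
  have ha := h .a
  have hh := fun i => h (.h i)
  have hp := fun i => h (.p i)
  have hZ := fun i => h (.Z i)
  simp only [coordGen] at hU ha hh hp hZ
  simp only [coset, map_mul, map_list_prod, List.map_ofFn, Function.comp_def, parityConj_exp,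
    map_smul, map_sum, hU, ha, hh, hp, hZ]

theorem cartanPart_mul_add (q v : Coord → ℝ) : cartanPart (q + v) = cartanPart q * cartanPart v := by
  rw [cartanPart, cartanPart, cartanPart, Matrix.diagonal_mul_diagonal]
  congr 1
  ext m
  rw [← Real.exp_add]
  congr 1
  simp only [Pi.add_apply, add_mul, Finset.sum_add_distrib]
  ring

/-- The Cartan factors stand on the right and commute with each other, so a shift of `h_j` is a
right translation at every point, not only on the dilaton locus. -/
theorem coset_add_single_h (q : Coord → ℝ) (j : Fin 3) (s : ℝ) :
    coset (q + s • Pi.single (.h j) 1) = coset q * NormedSpace.exp (s • cartan j.castSucc) := by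
  have h1 : unipotent (q + s • Pi.single (.h j) 1) = unipotent q := by
    simp [unipotent]
  have h2 : cartanPart (s • Pi.single (.h j) 1) = NormedSpace.exp (s • cartan j.castSucc) := by
    rw [exp_smul_cartan, cartanPart]
    congr 1
    ext m
    simp [Pi.single_apply]
  rw [coset_eq, coset_eq, cartanPart_mul_add, h1, h2, mul_assoc]

theorem unipotent_dilatons (h : Fin 3 → ℝ) : unipotent (dilatons h) = 1 := by
  simp [unipotent, dilatons]

theorem coset_dilatons (h : Fin 3 → ℝ) : coset (dilatons h) = cartanPart (dilatons h) := by
  rw [coset_eq, unipotent_dilatons, one_mul]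

/-- On the dilaton locus all other factors are trivial, so a single new coordinate contributes just
its own exponential on the left; the factor of `U` may be moved there because it is diagonal. -/
theorem coset_dilatons_add_single (h : Fin 3 → ℝ) {c : Coord} (hc : ∀ j, c ≠ .h j) (s : ℝ) :
    coset (dilatons h + s • Pi.single c 1)
      = NormedSpace.exp (s • coordGen c) * cartanPart (dilatons h) := by
  match c with
  | .h j => exact absurd rfl (hc j)
  | .U =>
    rw [coset_eq, cartanPart_mul_add]
    have h1 : unipotent (dilatons h + s • Pi.single .U 1) = 1 := by
      simp [unipotent, dilatons]
    have h2 : cartanPart (s • Pi.single .U 1) = NormedSpace.exp (s • L0) := by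
      rw [L0, smul_smul, exp_smul_cartan, cartanPart]
      congr 1
      ext m
      simp
      ring
    rw [h1, h2, one_mul, coordGen, L0, smul_smul, exp_smul_cartan, cartanPart,
      Matrix.diagonal_mul_diagonal, Matrix.diagonal_mul_diagonal]
    simp only [mul_comm]
  | .a =>
    rw [coset_eq, cartanPart_mul_add]
    have h1 : unipotent (dilatons h + s • Pi.single .a 1) = NormedSpace.exp (s • Lplus) := by
      simp [unipotent, dilatons]
    have h2 : cartanPart (s • Pi.single .a 1) = 1 := by
      simp [cartanPart]
    rw [h1, h2, mul_one, coordGen]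
  | .p r =>
    rw [coset_eq, cartanPart_mul_add]
    have h2 : cartanPart (s • Pi.single (.p r) 1) = 1 := by
      simp [cartanPart]
    have h1 : unipotent (dilatons h + s • Pi.single (.p r) 1)
        = NormedSpace.exp (s • spStep (r + 1)) := by
      simp only [unipotent, dilatons, Pi.add_apply]
      fin_cases r <;> simp [List.ofFn_succ]
    rw [h1, h2, mul_one, coordGen]
  | .Z m =>
    rw [coset_eq, cartanPart_mul_add]
    have h2 : cartanPart (s • Pi.single (.Z m) 1) = 1 := by
      simp [cartanPart]
    have h1 : unipotent (dilatons h + s • Pi.single (.Z m) 1)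
        = NormedSpace.exp (s • W (m + 1)) := by
      have h3 (i : Fin 14) : (dilatons h + s • Pi.single (Coord.Z m) 1 : Coord → ℝ) (Coord.Z i)
          = if i = m then s else 0 := by
        simp [dilatons, Pi.single_apply]
      rw [unipotent]
      simp only [h3, ite_smul, zero_smul, Finset.sum_ite_eq', Finset.mem_filter, Finset.mem_univ,
        true_and]
      rcases Nat.mod_two_eq_zero_or_one m with hm | hm <;> simp [hm, dilatons]
    rw [h1, h2, mul_one, coordGen]

/-! ## The invariant metric -/

section Differentiability

open scoped Matrix.Norms.Operator

theorem differentiable_coset : Differentiable ℝ coset := by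
  have h (f : (Coord → ℝ) → Matrix Idx Idx ℝ) (hf : Differentiable ℝ f) :
      Differentiable ℝ fun q => NormedSpace.exp (f q) := fun x =>
    ((NormedSpace.exp_analytic (𝕂 := ℝ) (f x)).differentiableAt).comp x (hf x)
  unfold coset
  simp only [List.ofFn_succ, List.ofFn_zero, List.prod_cons, List.prod_nil, mul_one]
  repeat' first | apply Differentiable.mul | apply h | fun_prop

theorem hasDerivAt_entry {f : ℝ → Matrix Idx Idx ℝ} {f' : Matrix Idx Idx ℝ} {s : ℝ}
    (h : HasDerivAt f f' s) (m n : Idx) : HasDerivAt (fun s => f s m n) (f' m n) s :=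
  (Matrix.entryLinearMap ℝ ℝ m n).toContinuousLinearMap.hasFDerivAt.comp_hasDerivAt s h

theorem hasDerivAt_trace {f : ℝ → Matrix Idx Idx ℝ} {f' : Matrix Idx Idx ℝ} {s : ℝ}
    (h : HasDerivAt f f' s) : HasDerivAt (fun s => (f s).trace) f'.trace s :=
  HasDerivAt.fun_sum fun m _ => hasDerivAt_entry h m m

theorem maurerCartan_of_hasDerivAt {q v : Coord → ℝ} {M : Matrix Idx Idx ℝ}
    (h : HasDerivAt (fun s : ℝ => coset (q + s • v)) M 0) :
    maurerCartan q v = (coset q)⁻¹ * M := by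
  rw [maurerCartan]
  congr 1
  ext m n
  exact (hasDerivAt_entry h m n).deriv

/-- The Maurer-Cartan form at `q` as a linear map. -/
noncomputable def maurerCartanLin (q : Coord → ℝ) : (Coord → ℝ) →ₗ[ℝ] Matrix Idx Idx ℝ :=
  LinearMap.mulLeft ℝ (coset q)⁻¹ ∘ₗ (fderiv ℝ coset q).toLinearMap

/-- Entrywise directional derivatives do not show linearity in `v`. Differentiability of `coset`
identifies them with the Fréchet derivative, which is linear. -/
theorem maurerCartan_eq (q v : Coord → ℝ) : maurerCartan q v = maurerCartanLin q v :=
  maurerCartan_of_hasDerivAt ((differentiable_coset q).hasFDerivAt.hasLineDerivAt v)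

theorem hasDerivAt_exp_smul (X : Matrix Idx Idx ℝ) :
    HasDerivAt (fun s : ℝ => NormedSpace.exp (s • X)) X 0 := by
  have h := hasDerivAt_exp_smul_const (𝕂 := ℝ) X 0
  rw [zero_smul, NormedSpace.exp_zero, one_mul] at h
  exact h

theorem maurerCartan_single_h (q : Coord → ℝ) (j : Fin 3) :
    maurerCartan q (Pi.single (.h j) 1) = cartan j.castSucc := by
  have h := (hasDerivAt_exp_smul (cartan j.castSucc)).const_mul (coset q)
  simp only [← coset_add_single_h] at h
  rw [maurerCartan_of_hasDerivAt h, ← mul_assoc, Matrix.nonsing_inv_mul _ (isUnit_det_coset q),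
    one_mul]

theorem maurerCartan_dilatons_single (h : Fin 3 → ℝ) {c : Coord} (hc : ∀ j, c ≠ .h j) :
    maurerCartan (dilatons h) (Pi.single c 1)
      = (coset (dilatons h))⁻¹ * (coordGen c * coset (dilatons h)) := by
  have h := (hasDerivAt_exp_smul (coordGen c)).mul_const (cartanPart (dilatons h))
  simp only [← coset_dilatons_add_single _ hc] at h
  rw [maurerCartan_of_hasDerivAt h, coset_dilatons]

end Differentiability

/-- The components of the Maurer-Cartan form along the Cartan generators (`Sum.inl`) and the step
operators (`Sum.inr`). -/
noncomputable def vielbein (X : Matrix Idx Idx ℝ) : Matrix Idx Idx ℝ →ₗ[ℝ] ℝ :=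
  (1 / 12 : ℝ) • (Matrix.traceLinearMap Idx ℝ ℝ ∘ₗ LinearMap.mulLeft ℝ X)

theorem vielbein_apply (X M : Matrix Idx Idx ℝ) : vielbein X M = (X * M).trace / 12 := by
  simp [vielbein]
  ring

/-- The metric at `q` as a bilinear form. -/
noncomputable def metricForm (q : Coord → ℝ) : (Coord → ℝ) →ₗ[ℝ] (Coord → ℝ) →ₗ[ℝ] ℝ :=
  ∑ i, (LinearMap.mul ℝ ℝ).compl₁₂ (vielbein (cartan i) ∘ₗ maurerCartanLin q)
    (vielbein (cartan i) ∘ₗ maurerCartanLin q)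
  + (1 / 2 : ℝ) • ∑ k ∈ Finset.Icc 1 24,
    (LinearMap.mul ℝ ℝ).compl₁₂ (vielbein (E (-1) k) ∘ₗ maurerCartanLin q)
      (vielbein (E (-1) k) ∘ₗ maurerCartanLin q)

theorem metric_eq (q v w : Coord → ℝ) : metric q v w = metricForm q v w := by
  simp [metric, metricForm, maurerCartan_eq, vielbein_apply]

theorem metric_comm (q v w : Coord → ℝ) : metric q v w = metric q w v := by
  simp only [metric, mul_comm]

theorem dilatons_eq_sum (v : Fin 3 → ℝ) : dilatons v = ∑ j, v j • Pi.single (.h j) 1 := by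
  ext c
  cases c <;> simp [dilatons, Pi.single_apply, Finset.sum_apply]

theorem maurerCartan_dilatons (q : Coord → ℝ) (v : Fin 3 → ℝ) :
    maurerCartan q (dilatons v) = ∑ j, v j • cartan j.castSucc := by
  rw [maurerCartan_eq, dilatons_eq_sum, map_sum]
  simp only [map_smul, ← maurerCartan_eq, maurerCartan_single_h]

theorem isRootVector_maurerCartan_dilatons (q : Coord → ℝ) (v : Fin 3 → ℝ) :
    IsRootVector (maurerCartan q (dilatons v)) 0 := by
  rw [maurerCartan_dilatons]
  intro m n h
  rw [Matrix.sum_apply] at h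
  obtain ⟨j, -, hj⟩ := Finset.exists_ne_zero_of_sum_ne_zero h
  exact ((isRootVector_cartan j.castSucc).smul (v j)) m n hj

theorem root_ne_zero : ∀ k ∈ Finset.Icc 1 24, root k ≠ 0 := by decide

/-- Along the dilatons the Maurer-Cartan form lies in the span of `ℋ₁, ℋ₂, ℋ₃`, so no step operator
component survives in the product. -/
theorem metric_dilatons_right (q v : Coord → ℝ) (w : Fin 3 → ℝ) :
    metric q v (dilatons w)
      = ∑ i, (cartan i.castSucc * maurerCartan q v).trace / 12 * w i := by
  have h1 : ∀ k ∈ Finset.Icc 1 24, (E (-1) k * maurerCartan q (dilatons w)).trace = 0 := by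
    intro k hk
    refine (isRootVector_E_neg_one k).trace_mul_eq_zero
      (isRootVector_maurerCartan_dilatons q w) ?_
    simpa using root_ne_zero k hk
  have h2 (i : Fin 4) : (cartan i * maurerCartan q (dilatons w)).trace / 12
      = ∑ j : Fin 3, w j * if i = j.castSucc then 1 else 0 := by
    rw [maurerCartan_dilatons, Matrix.mul_sum, Matrix.trace_sum, Finset.sum_div]
    refine Finset.sum_congr rfl fun j _ => ?_
    rw [Matrix.mul_smul, Matrix.trace_smul, trace_cartan_mul_cartan, smul_eq_mul]
    split_ifs <;> norm_num
  have h3 : ∑ k ∈ Finset.Icc 1 24, ((E (-1) k * maurerCartan q v).trace / 12)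
      * ((E (-1) k * maurerCartan q (dilatons w)).trace / 12) = 0 :=
    Finset.sum_eq_zero fun k hk => by rw [h1 k hk]; ring
  rw [metric, h3, mul_zero, add_zero]
  simp only [h2, Fin.sum_univ_four, Fin.sum_univ_three]
  simp [Fin.ext_iff]

/-- The metric pulled back to the dilatons is flat, at every point of the coset. -/
theorem metric_dilatons_dilatons (q : Coord → ℝ) (v w : Fin 3 → ℝ) :
    metric q (dilatons v) (dilatons w) = ∑ i, v i * w i := by
  rw [metric_dilatons_right]
  refine Finset.sum_congr rfl fun i _ => ?_
  rw [maurerCartan_dilatons, Matrix.mul_sum, Matrix.trace_sum, Finset.sum_div,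
    Finset.sum_eq_single i]
  · simp [trace_cartan_mul_cartan]
  · intro j _ hj
    simp [trace_cartan_mul_cartan, hj.symm]
  · simp

theorem trace_cartan_mul_coordGen (i : Fin 3) {c : Coord} (hc : ∀ j, c ≠ .h j) :
    (cartan i.castSucc * coordGen c).trace = 0 := by
  have hroot {k : ℕ} (hk : k ∈ Finset.Icc 1 24) (h : coordRoot c = root k) :
      (cartan i.castSucc * coordGen c).trace = 0 := by
    refine (isRootVector_cartan _).trace_mul_eq_zero (isRootVector_coordGen c) ?_
    rw [zero_add, h]
    exact root_ne_zero k hk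
  match c with
  | .h j => exact absurd rfl (hc j)
  | .U =>
    rw [coordGen, L0, Matrix.mul_smul, Matrix.trace_smul, trace_cartan_mul_cartan, if_neg]
    · simp
    · simp [Fin.ext_iff]; omega
  | .a => exact hroot (k := 24) (by decide) rfl
  | .p r =>
    have h : ∀ r, spIndex r ∈ Finset.Icc 1 24 := by decide
    exact hroot (h r) rfl
  | .Z m =>
    have h : ∀ m, heisenbergIndex m ∈ Finset.Icc 1 24 := by decide
    exact hroot (h m) rfl

/-- Here the Maurer-Cartan form is the generator conjugated with a diagonal matrix. That matrix
commutes with `ℋ_i`, so cyclicity of the trace removes it, and `ℋ_i` is trace-orthogonal to the root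
vectors and to `ℋ₄`. -/
theorem metric_single_dilatons (h v : Fin 3 → ℝ) {c : Coord} (hc : ∀ j, c ≠ .h j) :
    metric (dilatons h) (Pi.single c 1) (dilatons v) = 0 := by
  rw [metric_dilatons_right]
  refine Finset.sum_eq_zero fun i _ => ?_
  rw [maurerCartan_dilatons_single h hc, ← mul_assoc, ← mul_assoc, Matrix.trace_mul_comm]
  have hcomm : Commute (cartan i.castSucc) (coset (dilatons h))⁻¹ := by
    rw [coset_dilatons, cartanPart, Matrix.inv_diagonal]
    exact cartan_commute_diagonal _ _
  rw [hcomm.eq, ← mul_assoc, ← mul_assoc, Matrix.mul_nonsing_inv _ (isUnit_det_coset _), one_mul,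
    trace_cartan_mul_coordGen i hc]
  ring

/-! ## Parities of the moment maps -/

/-- The parities of `J^x`. -/
def jSign : Fin 3 → ℝ := ![-1, -1, 1]

theorem parityConj_E (j : Fin 4) (σ : ℤ) (k : ℕ) :
    parityConj j (E σ k) = (-1 : ℝ) ^ (σ * root k j) • E σ k := by
  rw [(isRootVector_E σ k).parityConj j]
  rfl

theorem parityConj_compact (j : Fin 4) (k : ℕ) :
    parityConj j (compact k) = (-1 : ℝ) ^ root k j • compact k := by
  rw [compact, map_sub, parityConj_E, parityConj_E, smul_sub]
  congr 2
  · rw [one_mul]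
  · rw [neg_one_mul, zpow_neg, ← inv_zpow]
    norm_num

theorem parityConj_compact_even (j : Fin 4) {k : ℕ} (hk : k ∈ [2, 9, 16, 24]) :
    parityConj j (compact k) = compact k := by
  have h : ∀ k ∈ [2, 9, 16, 24], ∀ j, Even (root k j) := by decide
  rw [parityConj_compact, (h k hk j).neg_one_zpow, one_smul]

theorem parityConj_compact_odd (j : Fin 4) {k : ℕ} (hk : k ∈ [1, 14, 20, 22, 5, 11, 18, 23]) :
    parityConj j (compact k) = -compact k := by
  have h : ∀ k ∈ [1, 14, 20, 22, 5, 11, 18, 23], ∀ j, Odd (root k j) := by decide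
  rw [parityConj_compact, (h k hk j).neg_one_zpow, neg_one_smul]

/-- The roots in `J¹` and `J²` are of the form `(±1, ±1, ±1, 1)`, odd in every component, while
those in `J³` are the `2ε_i`. Hence the sign does not depend on `j`. -/
theorem parityConj_J (j : Fin 4) (x : Fin 3) : parityConj j (J x) = jSign x • J x := by
  have ho {k : ℕ} (hk : k ∈ [1, 14, 20, 22, 5, 11, 18, 23]) := parityConj_compact_odd j hk
  have he {k : ℕ} (hk : k ∈ [2, 9, 16, 24]) := parityConj_compact_even j hk
  fin_cases x
  · simp only [J, jSign, Fin.zero_eta, Matrix.cons_val_zero, map_smul, map_sub, map_add,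
      ho (k := 1) (by decide), ho (k := 14) (by decide), ho (k := 20) (by decide),
      ho (k := 22) (by decide)]
    module
  · simp only [J, jSign, Fin.mk_one, Matrix.cons_val_one, Matrix.cons_val_zero, map_smul, map_sub,
      map_add, ho (k := 5) (by decide), ho (k := 11) (by decide), ho (k := 18) (by decide),
      ho (k := 23) (by decide)]
    module
  · simp only [J, jSign, Fin.reduceFinMk, Matrix.cons_val, map_neg, map_smul, map_sub, map_add,
      he (k := 2) (by decide), he (k := 9) (by decide), he (k := 16) (by decide),
      he (k := 24) (by decide), one_smul]

theorem parityConj_inv (j : Fin 4) {M : Matrix Idx Idx ℝ} (hM : IsUnit M.det) :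
    (parityConj j M)⁻¹ = parityConj j M⁻¹ :=
  Matrix.inv_eq_left_inv (by rw [← map_mul, Matrix.nonsing_inv_mul _ hM, map_one])

/-- The trace is invariant under conjugation, which fixes `t`, reflects the coset representative and
multiplies `J^x` by its sign. -/
theorem momentMap_reflect {t : Matrix Idx Idx ℝ} {j : Fin 4} (ht : parityConj j t = t) (x : Fin 3)
    (q : Coord → ℝ) : momentMap t x (reflect j q) = jSign x * momentMap t x q := by
  have h : jSign x • (J x * (coset (reflect j q))⁻¹ * t * coset (reflect j q))
      = parityConj j (J x * (coset q)⁻¹ * t * coset q) := by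
    rw [coset_reflect, parityConj_inv j (isUnit_det_coset q), map_mul, map_mul, map_mul, ht,
      parityConj_J]
    simp only [Matrix.smul_mul]
  have h2 := congrArg Matrix.trace h
  rw [trace_parityConj, Matrix.trace_smul, smul_eq_mul] at h2
  have h3 : jSign x * jSign x = 1 := by fin_cases x <;> simp [jSign]
  rw [momentMap, momentMap, ← h2, ← mul_assoc, h3, one_mul]

theorem potential_reflect {t : Matrix Idx Idx ℝ} {j : Fin 4} (ht : parityConj j t = t)
    (q : Coord → ℝ) : potential t (reflect j q) = potential t q := by
  have h3 (x : Fin 3) : jSign x ^ 2 = 1 := by fin_cases x <;> simp [jSign]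
  simp only [potential, momentMap_reflect ht, mul_pow, h3, one_mul]

/-! ### Differentiability of the potential and its even directions -/

section Differentiability

open scoped Matrix.Norms.Operator

theorem differentiable_momentMap (t : Matrix Idx Idx ℝ) (x : Fin 3) :
    Differentiable ℝ (momentMap t x) := by
  have hinv : Differentiable ℝ fun q => (coset q)⁻¹ := by
    simp only [Matrix.nonsing_inv_eq_ringInverse]
    exact fun q => (differentiableAt_inverse (isUnit_coset q)).comp q (differentiable_coset q)
  have h : Differentiable ℝ fun q => J x * (coset q)⁻¹ * t * coset q :=
    (((differentiable_const _).mul hinv).mul (differentiable_const _)).mul differentiable_coset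
  exact (Matrix.traceLinearMap Idx ℝ ℝ).toContinuousLinearMap.differentiable.comp h

end Differentiability

theorem differentiable_potential (t : Matrix Idx Idx ℝ) : Differentiable ℝ (potential t) :=
  Differentiable.fun_sum fun x _ => (differentiable_momentMap t x).pow 2

theorem hasDerivAt_zero_of_even {f : ℝ → ℝ} (hf : DifferentiableAt ℝ f 0)
    (heven : ∀ s, f (-s) = f s) : HasDerivAt f 0 0 := by
  have h := hf.hasDerivAt
  have h2 : HasDerivAt (fun s => f (-s)) (-deriv f 0) 0 := by
    have h' : HasDerivAt f (deriv f 0) (-(0 : ℝ)) := by rwa [neg_zero]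
    have h'' := h'.comp 0 (hasDerivAt_neg (0 : ℝ))
    rwa [mul_neg_one] at h''
  simp only [heven] at h2
  have h3 : deriv f 0 = 0 := by linarith [h.unique h2]
  rwa [h3] at h

/-- A parity-even potential is stationary in the odd directions at the fixed points of the
parity. -/
theorem stationaryAlong_of_odd {t : Matrix Idx Idx ℝ} {j : Fin 4} (ht : parityConj j t = t)
    {u : Coord → ℝ} (hu : reflect j u = u) {c : Coord} (hc : Odd (coordRoot c j)) :
    StationaryAlong (potential t) c u := by
  have huc : u c = 0 := by
    have := congrFun hu c
    rw [reflect, hc.neg_one_zpow] at this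
    linarith
  rw [StationaryAlong, huc]
  refine hasDerivAt_zero_of_even ?_ fun s => ?_
  · exact (differentiable_potential t _).comp (0 : ℝ) (hasDerivAt_update u c 0).differentiableAt
  · rw [← potential_reflect ht]
    congr 1
    ext d
    rcases eq_or_ne d c with rfl | hd
    · simp [reflect, hc.neg_one_zpow]
    · rw [reflect, Function.update_of_ne hd, Function.update_of_ne hd]
      exact congrFun hu d

/-! ## The gaugings -/

/-- The numbers of the roots of `stuStep`. -/
def stuIndex : Fin 3 → ℕ := ![16, 9, 2]

theorem stuIndex_mem (i : Fin 3) : stuIndex i ∈ [2, 9, 16] := by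
  revert i; decide

/-- For weights and commutators only proportionality matters; the actual sign is used in the trace
with `J³` alone. -/
theorem stuStep_eq (i : Fin 3) : ∃ ε : ℝ, stuStep i = ε • E 1 (stuIndex i) := by
  fin_cases i
  exacts [⟨1, (one_smul _ _).symm⟩, ⟨-1, (neg_one_smul _ _).symm⟩, ⟨1, (one_smul _ _).symm⟩]

theorem spStep_eq (r : Fin 9) : ∃ ε : ℝ, spStep (r + 1) = ε • E 1 (spIndex r) := by
  have h1 (M : Matrix Idx Idx ℝ) : ∃ ε : ℝ, M = ε • M := ⟨1, (one_smul _ _).symm⟩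
  have h2 (M : Matrix Idx Idx ℝ) : ∃ ε : ℝ, -M = ε • M := ⟨-1, (neg_one_smul _ _).symm⟩
  fin_cases r
  exacts [h1 _, h1 _, h1 _, h1 _, h2 _, h1 _, h2 _, h1 _, h1 _]

theorem isRootVector_stuStep (i : Fin 3) : IsRootVector (stuStep i) (root (stuIndex i)) := by
  obtain ⟨ε, h⟩ := stuStep_eq i
  exact h ▸ (isRootVector_E_one _).smul ε

theorem commute_stuStep (i j : Fin 3) : Commute (stuStep i) (stuStep j) := by
  obtain ⟨ε, h⟩ := stuStep_eq i
  obtain ⟨ε', h'⟩ := stuStep_eq j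
  rw [h, h']
  exact ((commute_E_long (stuIndex_mem i) (stuIndex_mem j)).smul_left _).smul_right _

theorem commute_spStep_E (r : Fin 9) {σ : ℤ} (hσ : σ ∈ ({1, -1} : Finset ℤ)) :
    Commute (spStep (r + 1)) (E σ 24) := by
  obtain ⟨ε, h⟩ := spStep_eq r
  have hr : ∀ r, spIndex r ∈ spRoots := by decide
  rw [h]
  exact (commute_E_highest (hr r) hσ).smul_left _

theorem commute_spStep_Lplus (r : Fin 9) : Commute (spStep (r + 1)) Lplus :=
  (commute_spStep_E r (by decide)).smul_right _

theorem commute_spStep_Lminus (r : Fin 9) : Commute (spStep (r + 1)) Lminus :=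
  (commute_spStep_E r (by decide)).smul_right _

theorem stuStep_eq_spStep (i : Fin 3) : ∃ r : Fin 9, stuStep i = spStep (r + 1) := by
  fin_cases i
  exacts [⟨8, rfl⟩, ⟨6, rfl⟩, ⟨2, rfl⟩]

theorem commute_stuStep_Lplus (i : Fin 3) : Commute (stuStep i) Lplus := by
  obtain ⟨r, hr⟩ := stuStep_eq_spStep i
  exact hr ▸ commute_spStep_Lplus r

theorem commute_stuStep_S (i : Fin 3) : Commute (stuStep i) S := by
  obtain ⟨r, hr⟩ := stuStep_eq_spStep i
  exact hr ▸ (commute_spStep_Lplus r).sub_right (commute_spStep_Lminus r)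

theorem commute_tSep (β κ : Fin 3 → ℝ) (i j : Fin 3) : Commute (tSep β κ i) (tSep β κ j) := by
  refine Commute.sub_left (Commute.smul_left ?_ _) (Commute.smul_left ?_ _) <;>
  refine Commute.sub_right (Commute.smul_right ?_ _) (Commute.smul_right ?_ _)
  exacts [commute_stuStep i j, commute_stuStep_S i, (commute_stuStep_S j).symm, Commute.refl S]

/-- Through this, every statement about `VSTU` carries over to the summands of `VSep`. -/
theorem tSep_eq (β κ : Fin 3 → ℝ) (i : Fin 3) : tSep β κ i = tSTU (Pi.single i (β i)) (κ i) := by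
  rw [tSep, tSTU, Finset.sum_eq_single i]
  · simp
  · intro j _ hj
    simp [hj]
  · simp

theorem VSep_eq (β κ : Fin 3 → ℝ) (q : Coord → ℝ) :
    VSep β κ q = ∑ i, VSTU (Pi.single i (β i)) (κ i) q := by
  simp only [VSep, VSTU, tSep_eq]

theorem parityConj_tSTU (j : Fin 4) (β : Fin 3 → ℝ) (κ : ℝ) :
    parityConj j (tSTU β κ) = tSTU β κ := by
  have h1 : ∀ i j, Even (root (stuIndex i) j) := by decide
  have h2 : ∀ j, Even (root 24 j) := by decide
  have hs (i : Fin 3) : parityConj j (stuStep i) = stuStep i := by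
    rw [(isRootVector_stuStep i).parityConj, (h1 i j).neg_one_zpow, one_smul]
  have hE (σ : ℤ) : parityConj j (E σ 24) = E σ 24 := by
    rw [parityConj_E, ((h2 j).mul_left σ).neg_one_zpow, one_smul]
  simp only [tSTU, map_sub, map_sum, map_smul, hs, S, Lplus, Lminus, hE]

theorem reflect_dilatons (j : Fin 4) (h : Fin 3 → ℝ) : reflect j (dilatons h) = dilatons h := by
  ext c
  cases c <;> simp [reflect, dilatons, coordRoot]

/-- The fourth component grades the solvable generators: 0 on the Cartan and sp(6) generators, 1 on
the Heisenberg generators, 2 on `L₊`. This parity therefore flips the `Z_m` only. -/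
theorem reflect_three {u : Coord → ℝ} (ha : u .a = 0) (hZ : ∀ m, u (.Z m) = 0) :
    reflect 3 u = u := by
  have hp : ∀ r, root (spIndex r) 3 = 0 := by decide
  ext c
  cases c <;> simp [reflect, coordRoot, ha, hZ, hp]

theorem stationaryAlong_Z (β : Fin 3 → ℝ) (κ : ℝ) {u : Coord → ℝ} (ha : u .a = 0)
    (hZ : ∀ m, u (.Z m) = 0) (m : Fin 14) : StationaryAlong (VSTU β κ) (.Z m) u := by
  have h : ∀ m, Odd (root (heisenbergIndex m) 3) := by decide
  exact stationaryAlong_of_odd (parityConj_tSTU 3 β κ) (reflect_three ha hZ) (h m)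

theorem momentMap_eq_zero (β : Fin 3 → ℝ) (κ : ℝ) {u : Coord → ℝ} (hu : reflect 3 u = u)
    {x : Fin 3} (hx : x ≠ 2) : momentMap (tSTU β κ) x u = 0 := by
  have h := momentMap_reflect (parityConj_tSTU 3 β κ) x u
  have hs : jSign x = -1 := by
    fin_cases x
    · rfl
    · rfl
    · exact absurd rfl hx
  rw [hu, hs] at h
  linarith

/-- `P¹` and `P²` are odd and vanish at fixed points of the parity, so stationarity within the fixed
locus concerns `P³` only. -/
theorem VSTU_eq (β : Fin 3 → ℝ) (κ : ℝ) {u : Coord → ℝ} (hu : reflect 3 u = u) :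
    VSTU β κ u = momentMap (tSTU β κ) 2 u ^ 2 := by
  rw [VSTU, potential, Fin.sum_univ_three, momentMap_eq_zero β κ hu (by decide),
    momentMap_eq_zero β κ hu (by decide)]
  ring

/-! ### Traces with `J³` -/

theorem trace_compact_mul_E {j k : ℕ} (hj : j ∈ [2, 9, 16, 24]) (hk : k ∈ [2, 9, 16, 24]) :
    (compact j * E 1 k).trace = if j = k then -12 else 0 := by
  have h1 : ∀ j ∈ [2, 9, 16, 24], ∀ k ∈ [2, 9, 16, 24],
    (1 : ℤ) • root j + (1 : ℤ) • root k ≠ 0 := by decide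
  have h2 : ∀ j ∈ [2, 9, 16, 24], ∀ k ∈ [2, 9, 16, 24], j ≠ k →
    (-1 : ℤ) • root j + (1 : ℤ) • root k ≠ 0 := by decide
  rw [compact, sub_mul, Matrix.trace_sub, trace_E_mul_E_of_ne (h1 j hj k hk)]
  split_ifs with h
  · rw [h, trace_E_mul_E hk]
    norm_num
  · rw [trace_E_mul_E_of_ne (h2 j hj k hk h), sub_zero]

theorem trace_compact_mul_E_neg {j k : ℕ} (hj : j ∈ [2, 9, 16, 24]) (hk : k ∈ [2, 9, 16, 24]) :
    (compact j * E (-1) k).trace = if j = k then 12 else 0 := by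
  have h1 : ∀ j ∈ [2, 9, 16, 24], ∀ k ∈ [2, 9, 16, 24],
    (-1 : ℤ) • root j + (-1 : ℤ) • root k ≠ 0 := by decide
  have h2 : ∀ j ∈ [2, 9, 16, 24], ∀ k ∈ [2, 9, 16, 24], j ≠ k →
    (1 : ℤ) • root j + (-1 : ℤ) • root k ≠ 0 := by decide
  rw [compact, sub_mul, Matrix.trace_sub, trace_E_mul_E_of_ne (h1 j hj k hk)]
  split_ifs with h
  · rw [h, Matrix.trace_mul_comm, trace_E_mul_E hk, sub_zero]
  · rw [trace_E_mul_E_of_ne (h2 j hj k hk h), sub_zero]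

theorem trace_J_two_mul (M : Matrix Idx Idx ℝ) : (J 2 * M).trace
    = -(1 / (4 * √2)) * ((compact 2 * M).trace - (compact 9 * M).trace + (compact 16 * M).trace
      + (compact 24 * M).trace) := by
  simp only [J, Matrix.cons_val, Matrix.neg_mul, Matrix.trace_neg, Matrix.smul_mul,
    Matrix.trace_smul, Matrix.add_mul, Matrix.sub_mul, Matrix.trace_add, Matrix.trace_sub,
    smul_eq_mul]
  ring

/-- `J³` is a combination of root vectors with non-zero roots only. -/
theorem trace_J_two_mul_of_weight_zero {M : Matrix Idx Idx ℝ} (hM : IsRootVector M 0) :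
    (J 2 * M).trace = 0 := by
  have h {k : ℕ} (hk : k ∈ Finset.Icc 1 24) : (compact k * M).trace = 0 := by
    have h1 : root k + 0 ≠ 0 := by simpa using root_ne_zero k hk
    have h2 : -root k + 0 ≠ 0 := by simpa using root_ne_zero k hk
    rw [compact, sub_mul, Matrix.trace_sub, (isRootVector_E_one k).trace_mul_eq_zero hM h1,
      (isRootVector_E_neg_one k).trace_mul_eq_zero hM h2, sub_zero]
  rw [trace_J_two_mul, h (by decide), h (by decide), h (by decide), h (by decide)]
  ring

theorem trace_J_two_mul_E (k : ℕ) (hk : k ∈ [2, 9, 16, 24]) :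
    (J 2 * E 1 k).trace = (if k = 9 then -1 else 1) * (3 / √2) := by
  rw [trace_J_two_mul, trace_compact_mul_E (by decide) hk, trace_compact_mul_E (by decide) hk,
    trace_compact_mul_E (by decide) hk, trace_compact_mul_E (by decide) hk]
  simp only [List.mem_cons, List.not_mem_nil, or_false] at hk
  rcases hk with rfl | rfl | rfl | rfl <;> norm_num <;> ring

theorem trace_J_two_mul_E_neg : (J 2 * E (-1) 24).trace = -(3 / √2) := by
  rw [trace_J_two_mul, trace_compact_mul_E_neg (by decide) (by decide),
    trace_compact_mul_E_neg (by decide) (by decide),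
    trace_compact_mul_E_neg (by decide) (by decide),
    trace_compact_mul_E_neg (by decide) (by decide)]
  norm_num
  ring

/-- The minus sign of `H₉` in `J³` cancels the one in `ℰ^{α₇} = -E^{β₉}`. This is why the three
parameters enter the potential through their sum. -/
theorem trace_J_two_mul_stuStep (i : Fin 3) : (J 2 * stuStep i).trace = 3 / √2 := by
  fin_cases i
  · exact (trace_J_two_mul_E 16 (by decide)).trans (by norm_num)
  · change (J 2 * -E 1 9).trace = _
    rw [Matrix.mul_neg, Matrix.trace_neg, trace_J_two_mul_E 9 (by decide)]
    norm_num
  · exact (trace_J_two_mul_E 2 (by decide)).trans (by norm_num)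

theorem trace_J_two_mul_tSTU (β : Fin 3 → ℝ) (κ : ℝ) :
    (J 2 * tSTU β κ).trace = 3 / √2 * ∑ i, β i - 3 * κ := by
  have h2 : √2 * √2 = 2 := Real.mul_self_sqrt (by norm_num)
  have hS : (J 2 * S).trace = 3 := by
    rw [S, Lplus, Lminus, mul_sub, Matrix.trace_sub, Matrix.mul_smul, Matrix.mul_smul,
      Matrix.trace_smul, Matrix.trace_smul, trace_J_two_mul_E 24 (by decide),
      trace_J_two_mul_E_neg, smul_eq_mul, smul_eq_mul]
    field_simp
    norm_num
  rw [tSTU, mul_sub, Matrix.trace_sub, Matrix.mul_sum, Matrix.trace_sum, Matrix.mul_smul,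
    Matrix.trace_smul, hS, Finset.mul_sum]
  simp only [Matrix.mul_smul, Matrix.trace_smul, trace_J_two_mul_stuStep, smul_eq_mul]
  rw [mul_comm κ]
  simp only [mul_comm]

/-! ### Stationarity along `U` and `a` -/

theorem update_eq_add {u : Coord → ℝ} {c : Coord} (hc : u c = 0) (s : ℝ) :
    Function.update u c s = u + s • Pi.single c 1 := by
  ext d
  rcases eq_or_ne d c with rfl | hd
  · simp [hc]
  · simp [hd]

theorem coset_add_single_U (q : Coord → ℝ) (s : ℝ) :
    coset (q + s • Pi.single .U 1) = coset q * NormedSpace.exp (s • L0) := by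
  have h1 : unipotent (q + s • Pi.single .U 1) = unipotent q := by
    simp [unipotent]
  have h2 : cartanPart (s • Pi.single .U 1) = NormedSpace.exp (s • L0) := by
    rw [L0, smul_smul, exp_smul_cartan, cartanPart]
    congr 1
    ext m
    simp
    ring
  rw [coset_eq, coset_eq, cartanPart_mul_add, h1, h2, mul_assoc]

theorem coset_add_single_a {q : Coord → ℝ} (hq : q .a = 0) (s : ℝ) :
    coset (q + s • Pi.single .a 1) = NormedSpace.exp (s • Lplus) * coset q := by
  have h1 : unipotent (q + s • Pi.single .a 1) = NormedSpace.exp (s • Lplus) * unipotent q := by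
    simp [unipotent, hq, mul_assoc]
  have h2 : cartanPart (s • Pi.single .a 1) = 1 := by
    simp [cartanPart]
  rw [coset_eq, coset_eq, cartanPart_mul_add, h1, h2, mul_one, mul_assoc]

/-- What commutes with `sp(6)` and the dilaton generators commutes with the coset representative
at `Z = U = a = 0`. -/
theorem commute_coset {M : Matrix Idx Idx ℝ} (hp : ∀ r : Fin 9, Commute (spStep (r + 1)) M)
    (hh : ∀ j : Fin 3, Commute (cartan j.castSucc) M) {u : Coord → ℝ} (hU : u .U = 0)
    (ha : u .a = 0) (hZ : ∀ m, u (.Z m) = 0) : Commute M (coset u) := by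
  have hexp {X : Matrix Idx Idx ℝ} (s : ℝ) (h : Commute X M) :
      Commute M (NormedSpace.exp (s • X)) := by
    open scoped Matrix.Norms.Operator in
    exact ((h.smul_left s).symm).exp_right
  have : coset u = (List.ofFn fun i : Fin 9 => NormedSpace.exp (u (.p i.rev) •
      spStep (i.rev + 1))).prod
      * (List.ofFn fun j : Fin 3 => NormedSpace.exp (u (.h j) • cartan j.castSucc)).prod := by
    simp only [coset, hU, ha, hZ, zero_smul, Finset.sum_const_zero, NormedSpace.exp_zero, one_mul,
      mul_one]
  rw [this]
  refine Commute.mul_right (Commute.list_prod_right _ _ ?_) (Commute.list_prod_right _ _ ?_) <;>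
  intro x hx <;> obtain ⟨i, rfl⟩ := List.mem_ofFn.1 hx
  exacts [hexp _ (hp _), hexp _ (hh _)]

theorem commute_cartan_highest (j : Fin 3) : Commute (cartan j.castSucc) (E 1 24) ∧
    Commute (cartan j.castSucc) (E (-1) 24) := by
  have h : ∀ j : Fin 3, root 24 j.castSucc = 0 := by decide
  refine ⟨(isRootVector_E_one 24).commute_cartan (h j),
    (isRootVector_E_neg_one 24).commute_cartan ?_⟩
  rw [Pi.neg_apply, h j, neg_zero]

section

variable {u : Coord → ℝ}

theorem commute_S_coset (hU : u .U = 0) (ha : u .a = 0) (hZ : ∀ m, u (.Z m) = 0) :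
    Commute S (coset u) :=
  commute_coset (fun r => (commute_spStep_Lplus r).sub_right (commute_spStep_Lminus r))
    (fun j => ((commute_cartan_highest j).1.smul_right _).sub_right
      ((commute_cartan_highest j).2.smul_right _)) hU ha hZ

theorem commute_L0_coset (hU : u .U = 0) (ha : u .a = 0) (hZ : ∀ m, u (.Z m) = 0) :
    Commute L0 (coset u) := by
  have hroot : ∀ r, root (spIndex r) 3 = 0 := by decide
  refine commute_coset (fun r => ?_) (fun j => ?_) hU ha hZ
  · exact (((isRootVector_coordGen (.p r)).commute_cartan (hroot r)).smul_left _).symm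
  · rw [L0, cartan_eq 3]
    exact (cartan_commute_diagonal _ _).smul_right _

theorem commute_L0_stuStep (i : Fin 3) : Commute L0 (stuStep i) := by
  have hroot : ∀ i, root (stuIndex i) 3 = 0 := by decide
  exact ((isRootVector_stuStep i).commute_cartan (hroot i)).smul_left _

theorem commute_inv_of_isUnit_det {M N : Matrix Idx Idx ℝ} (h : Commute M N)
    (hN : IsUnit N.det) : Commute M N⁻¹ := by
  have : N⁻¹ * (N * M) * N⁻¹ = N⁻¹ * (M * N) * N⁻¹ := by rw [h.eq]
  rw [← mul_assoc, Matrix.nonsing_inv_mul _ hN, one_mul, mul_assoc N⁻¹, mul_assoc M,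
    Matrix.mul_nonsing_inv _ hN, mul_one] at this
  exact this

theorem lie_L0_S : L0 * S - S * L0 = Lplus + Lminus := by
  have h1 := (isRootVector_E_one 24).cartan_mul 3
  have h2 := (isRootVector_E_neg_one 24).cartan_mul 3
  have hr : root 24 3 = 2 := by decide
  rw [Pi.neg_apply, hr] at h2
  rw [hr] at h1
  rw [S, Lplus, Lminus, L0]
  simp only [mul_sub, sub_mul, Matrix.smul_mul, Matrix.mul_smul, h1, h2]
  push_cast
  module

/-- `J³` is compact and `L₊ + L₋` is non-compact. -/
theorem trace_J_two_mul_Lplus_add_Lminus : (J 2 * (Lplus + Lminus)).trace = 0 := by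
  rw [Lplus, Lminus, mul_add, Matrix.trace_add, Matrix.mul_smul, Matrix.mul_smul,
    Matrix.trace_smul, Matrix.trace_smul, trace_J_two_mul_E 24 (by decide), trace_J_two_mul_E_neg]
  norm_num

/-- `V_STU` is stationary along a curve that starts at a fixed point of the parity if `P³` is and
the curve stays in the locus where `P¹` and `P²` vanish. -/
theorem stationaryAlong_of_momentMap {β : Fin 3 → ℝ} {κ : ℝ} {c : Coord}
    (hc : u c = 0) (hu : ∀ s, reflect 3 (Function.update u c s) = Function.update u c s)
    (h : HasDerivAt (fun s : ℝ => momentMap (tSTU β κ) 2 (u + s • Pi.single c 1)) 0 0) :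
    StationaryAlong (VSTU β κ) c u := by
  rw [StationaryAlong, hc]
  have hV (s : ℝ) : VSTU β κ (Function.update u c s)
      = momentMap (tSTU β κ) 2 (u + s • Pi.single c 1) ^ 2 := by
    rw [VSTU_eq β κ (hu s), update_eq_add hc]
  simp only [hV]
  simpa using h.fun_pow 2

-- The derivative of `e^{-sX} B e^{sX}` at 0 is `[B, X]`. The outer factors `A` and `C` serve both
-- placements of the exponential: to the right of the coset representative for `U`, to its left for
-- `a`.
open scoped Matrix.Norms.Operator in
theorem hasDerivAt_trace_conj (A B C X : Matrix Idx Idx ℝ) :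
    HasDerivAt (fun s : ℝ =>
      (A * (NormedSpace.exp (s • X))⁻¹ * B * NormedSpace.exp (s • X) * C).trace)
      (A * (B * X - X * B) * C).trace 0 := by
  have h1 := hasDerivAt_exp_smul X
  have h2 : HasDerivAt (fun s : ℝ => (NormedSpace.exp (s • X))⁻¹) (-X) 0 := by
    simp only [← Matrix.exp_neg, ← smul_neg]
    exact hasDerivAt_exp_smul (-X)
  have h3 := ((((h2.const_mul A).mul_const B).mul h1).mul_const C)
  have h4 := hasDerivAt_trace h3
  have h0 : NormedSpace.exp ((0 : ℝ) • X) = 1 := by rw [zero_smul, NormedSpace.exp_zero]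
  convert h4 using 2
  · rfl
  rw [h0, inv_one, mul_one, mul_one]
  congr 1
  noncomm_ring

theorem stationaryAlong_U (β : Fin 3 → ℝ) (κ : ℝ) (hU : u .U = 0) (ha : u .a = 0)
    (hZ : ∀ m, u (.Z m) = 0) : StationaryAlong (VSTU β κ) .U u := by
  refine stationaryAlong_of_momentMap hU (fun s => reflect_three (by simp [ha]) (by simp [hZ])) ?_
  have hdet := isUnit_det_coset u
  have h := hasDerivAt_trace_conj (J 2) ((coset u)⁻¹ * tSTU β κ * coset u) 1 L0
  have hA : Commute L0 ((coset u)⁻¹ * (∑ i, β i • stuStep i) * coset u) := by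
    have hc := commute_L0_coset hU ha hZ
    refine ((commute_inv_of_isUnit_det hc hdet).mul_right ?_).mul_right hc
    exact Commute.sum_right _ _ _ fun i _ => (commute_L0_stuStep i).smul_right _
  have hS : (coset u)⁻¹ * S * coset u = S := by
    rw [mul_assoc, (commute_S_coset hU ha hZ).eq, ← mul_assoc, Matrix.nonsing_inv_mul _ hdet,
      one_mul]
  have hval : (J 2 * ((coset u)⁻¹ * tSTU β κ * coset u * L0
      - L0 * ((coset u)⁻¹ * tSTU β κ * coset u)) * 1).trace = 0 := by
    -- The sp(6) part of the dressed generator has zero fourth weight and commutes with `L₀`, and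
    -- `𝔖` is not changed by the dressing. Only the commutator of `L₀` with `𝔖` survives.
    have : (coset u)⁻¹ * tSTU β κ * coset u * L0 - L0 * ((coset u)⁻¹ * tSTU β κ * coset u)
        = κ • (L0 * S - S * L0) := by
      rw [tSTU, mul_sub, sub_mul, Matrix.mul_smul, Matrix.smul_mul, hS, mul_sub, sub_mul, hA.eq,
        Matrix.mul_smul, Matrix.smul_mul, smul_sub]
      abel
    rw [this, lie_L0_S, mul_one, Matrix.mul_smul, Matrix.trace_smul,
      trace_J_two_mul_Lplus_add_Lminus, smul_zero]
  rw [hval] at h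
  convert h using 2 with s
  rw [momentMap, coset_add_single_U, Matrix.mul_inv_rev]
  simp only [mul_assoc, mul_one]

theorem stationaryAlong_a (β : Fin 3 → ℝ) (κ : ℝ) (hU : u .U = 0) (ha : u .a = 0)
    (hZ : ∀ m, u (.Z m) = 0) : StationaryAlong (VSTU β κ) .a u := by
  have hr : ∀ j, Even (root 24 j) := by decide
  have hred : ∀ s, reflect 3 (Function.update u .a s) = Function.update u .a s := by
    intro s
    ext c
    rcases eq_or_ne c .a with rfl | hc
    · simp [reflect, coordRoot, (hr 3).neg_one_zpow]
    · rw [reflect, Function.update_of_ne hc]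
      exact congrFun (reflect_three ha hZ) c
  refine stationaryAlong_of_momentMap ha hred ?_
  have hdet := isUnit_det_coset u
  have h := hasDerivAt_trace_conj (J 2 * (coset u)⁻¹) (tSTU β κ) (coset u) Lplus
  have hval : (J 2 * (coset u)⁻¹ * (tSTU β κ * Lplus - Lplus * tSTU β κ) * coset u).trace = 0 := by
    have hA : Commute (∑ i, β i • stuStep i) Lplus :=
      Commute.sum_left _ _ _ fun i _ => (commute_stuStep_Lplus i).smul_left _
    -- Only the `L₋` in `𝔖` fails to commute with `L₊`. The commutator has weight zero and commutes
    -- with the coset representative, so the dressing drops out.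
    have h1 : tSTU β κ * Lplus - Lplus * tSTU β κ = κ • (Lminus * Lplus - Lplus * Lminus) := by
      rw [tSTU, sub_mul, mul_sub, hA.eq, S, Matrix.smul_mul, Matrix.mul_smul, sub_mul, mul_sub,
        smul_sub, smul_sub, smul_sub]
      abel
    have h2 : Commute (Lminus * Lplus - Lplus * Lminus) (coset u) := by
      have hm : Commute Lminus (coset u) := commute_coset commute_spStep_Lminus
        (fun j => (commute_cartan_highest j).2.smul_right _) hU ha hZ
      have hp : Commute Lplus (coset u) := commute_coset commute_spStep_Lplus
        (fun j => (commute_cartan_highest j).1.smul_right _) hU ha hZ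
      exact (hm.mul_left hp).sub_left (hp.mul_left hm)
    have h3 : IsRootVector (Lminus * Lplus - Lplus * Lminus) 0 := by
      have hm : IsRootVector Lminus (-root 24) := (isRootVector_E_neg_one 24).smul _
      have hp : IsRootVector Lplus (root 24) := (isRootVector_E_one 24).smul _
      have h4 := hm.mul hp
      have h5 := hp.mul hm
      rw [neg_add_cancel] at h4
      rw [add_neg_cancel] at h5
      exact h4.sub h5
    rw [h1, mul_assoc, Matrix.smul_mul, h2.eq, Matrix.mul_smul, ← mul_assoc, mul_assoc (J 2),
      Matrix.nonsing_inv_mul _ hdet, mul_one, Matrix.trace_smul,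
      trace_J_two_mul_of_weight_zero h3, smul_zero]
  rw [hval] at h
  convert h using 2 with s
  rw [momentMap, coset_add_single_a ha, Matrix.mul_inv_rev]
  simp only [mul_assoc]

end

/-! ### The dilatons -/

/-- A left factor that commutes with `t` cancels in `𝕃⁻¹ t 𝕃`. -/
theorem momentMap_const_along {t T : Matrix Idx Idx ℝ} (h : Commute T t) (x : Fin 3)
    (D : Matrix Idx Idx ℝ) (s : ℝ) :
    (J x * (NormedSpace.exp (s • T) * D)⁻¹ * t * (NormedSpace.exp (s • T) * D)).trace
      = (J x * D⁻¹ * t * D).trace := by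
  have h1 : Commute (NormedSpace.exp (s • T)) t := by
    open scoped Matrix.Norms.Operator in
    exact (h.smul_left s).exp_left
  have hu : IsUnit (NormedSpace.exp (s • T)).det :=
    (Matrix.isUnit_iff_isUnit_det _).1 (Matrix.isUnit_exp _)
  have h2 : (NormedSpace.exp (s • T))⁻¹ * t * NormedSpace.exp (s • T) = t := by
    rw [mul_assoc, ← h1.eq, ← mul_assoc, Matrix.nonsing_inv_mul _ hu, one_mul]
  rw [Matrix.mul_inv_rev]
  have h3 : J x * (D⁻¹ * (NormedSpace.exp (s • T))⁻¹) * t * (NormedSpace.exp (s • T) * D)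
      = J x * D⁻¹ * ((NormedSpace.exp (s • T))⁻¹ * t * NormedSpace.exp (s • T)) * D := by
    simp only [mul_assoc]
  rw [h3, h2]

theorem stationaryAlong_p (β : Fin 3 → ℝ) (κ : ℝ) (h : Fin 3 → ℝ) (r : Fin 9) :
    StationaryAlong (VSTU β κ) (.p r) (dilatons h) := by
  -- The six short roots of sp(6) have odd components; the three long ones are the roots of the
  -- `stuStep`.
  have hr : ∀ r, (∃ j, Odd (root (spIndex r) j)) ∨ ∃ i, spIndex r = stuIndex i := by decide
  rcases hr r with ⟨j, hj⟩ | ⟨i, hi⟩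
  · exact stationaryAlong_of_odd (parityConj_tSTU j β κ) (reflect_dilatons j h) hj
  · have hcomm : Commute (spStep (r + 1)) (tSTU β κ) := by
      refine Commute.sub_right (Commute.sum_right _ _ _ fun k _ => Commute.smul_right ?_ _)
        (Commute.smul_right ((commute_spStep_Lplus r).sub_right (commute_spStep_Lminus r)) _)
      obtain ⟨ε, hε⟩ := spStep_eq r
      obtain ⟨ε', hε'⟩ := stuStep_eq k
      rw [hε, hε', hi]
      exact ((commute_E_long (stuIndex_mem i) (stuIndex_mem k)).smul_left _).smul_right _
    have h0 : dilatons h (.p r) = 0 := rfl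
    rw [StationaryAlong, h0]
    have hconst (s : ℝ) : VSTU β κ (Function.update (dilatons h) (.p r) s)
        = ∑ x, (J x * (cartanPart (dilatons h))⁻¹ * tSTU β κ
          * cartanPart (dilatons h)).trace ^ 2 := by
      rw [update_eq_add h0]
      simp only [VSTU, potential, momentMap, coset_dilatons_add_single h (c := .p r) (by simp),
        coordGen, momentMap_const_along hcomm]
    simp only [hconst]
    exact hasDerivAt_const _ _

theorem stationaryAlong_dilatons (β : Fin 3 → ℝ) (κ : ℝ) (h : Fin 3 → ℝ) {c : Coord}
    (hc : ∀ j, c ≠ .h j) : StationaryAlong (VSTU β κ) c (dilatons h) :=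
  match c with
  | .h j => absurd rfl (hc j)
  | .U => stationaryAlong_U β κ rfl rfl fun _ => rfl
  | .a => stationaryAlong_a β κ rfl rfl fun _ => rfl
  | .p r => stationaryAlong_p β κ h r
  | .Z m => stationaryAlong_Z β κ rfl (fun _ => rfl) m

/-- Conjugation with a diagonal matrix scales the entry at `(m, n)` by an exponential of the weight
difference, which is `α` for all non-zero entries. -/
theorem IsRootVector.conj_dilatons {M : Matrix Idx Idx ℝ} {α : Fin 4 → ℤ} (hM : IsRootVector M α)
    (h : Fin 3 → ℝ) : (coset (dilatons h))⁻¹ * M * coset (dilatons h)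
      = Real.exp (-∑ j, h j * α j.castSucc) • M := by
  have hinv : (cartanPart (dilatons h))⁻¹ = cartanPart (dilatons (-h)) := by
    refine Matrix.inv_eq_left_inv ?_
    rw [← cartanPart_mul_add]
    have : dilatons (-h) + dilatons h = 0 := by
      ext c
      cases c <;> simp [dilatons]
    rw [this]
    simp [cartanPart]
  rw [coset_dilatons, hinv]
  ext m n
  rw [cartanPart, cartanPart, Matrix.mul_diagonal, Matrix.diagonal_mul, Matrix.smul_apply,
    smul_eq_mul]
  by_cases h0 : M m n = 0
  · simp [h0]
  · rw [mul_right_comm, ← Real.exp_add, hM m n h0]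
    congr 2
    simp only [dilatons, Pi.neg_apply, Pi.add_apply, Int.cast_add, Fin.sum_univ_three]
    ring

theorem conj_tSTU_dilatons (β : Fin 3 → ℝ) (κ : ℝ) (h : Fin 3 → ℝ) :
    (coset (dilatons h))⁻¹ * tSTU β κ * coset (dilatons h)
      = tSTU (fun i => β i * Real.exp (-2 * h i)) κ := by
  have hS : (coset (dilatons h))⁻¹ * S * coset (dilatons h) = S := by
    rw [mul_assoc, (commute_S_coset rfl rfl fun _ => rfl).eq, ← mul_assoc,
      Matrix.nonsing_inv_mul _ (isUnit_det_coset _), one_mul]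
  have hstu (i : Fin 3) : (coset (dilatons h))⁻¹ * stuStep i * coset (dilatons h)
      = Real.exp (-2 * h i) • stuStep i := by
    rw [(isRootVector_stuStep i).conj_dilatons]
    congr 2
    have hr : ∀ i (j : Fin 3), root (stuIndex i) j.castSucc = if j = i then 2 else 0 := by decide
    simp [hr]
    ring
  rw [tSTU, mul_sub, sub_mul, Matrix.mul_sum, Matrix.sum_mul, Matrix.mul_smul, Matrix.smul_mul, hS,
    tSTU]
  simp only [Matrix.mul_smul, Matrix.smul_mul, hstu, smul_smul]

theorem VSTU_dilatons (β : Fin 3 → ℝ) (κ : ℝ) (h : Fin 3 → ℝ) : VSTU β κ (dilatons h)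
    = 9 / 4 * (2 * κ - √2 * ∑ i, β i * Real.exp (-2 * h i)) ^ 2 := by
  have h2 : √2 * √2 = 2 := Real.mul_self_sqrt (by norm_num)
  rw [VSTU_eq β κ (reflect_dilatons 3 h), momentMap, mul_assoc, mul_assoc,
    ← mul_assoc (coset (dilatons h))⁻¹, conj_tSTU_dilatons, trace_J_two_mul_tSTU]
  -- With this, `3/√2 · ∑ - 3κ = -(3/2)(2κ - √2 ∑)`, whose square gives the prefactor 9/4.
  have h3 : 3 / √2 = 3 / 2 * √2 := by
    field_simp
    linarith
  rw [h3]
  ring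

theorem VSep_dilatons (β κ : Fin 3 → ℝ) (h : Fin 3 → ℝ) : VSep β κ (dilatons h)
    = 9 / 4 * ∑ i, (2 * κ i - √2 * Real.exp (-2 * h i) * β i) ^ 2 := by
  rw [VSep_eq, Finset.mul_sum]
  refine Finset.sum_congr rfl fun i _ => ?_
  rw [VSTU_dilatons, Finset.sum_eq_single i]
  · rw [Pi.single_eq_same]
    ring
  · intro j _ hj
    simp [hj]
  · simp

theorem StationaryAlong.VSep {β κ : Fin 3 → ℝ} {c : Coord} {u : Coord → ℝ}
    (h : ∀ i, StationaryAlong (VSTU (Pi.single i (β i)) (κ i)) c u) :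
    StationaryAlong (VSep β κ) c u := by
  have h2 := HasDerivAt.fun_sum (u := Finset.univ) fun i _ => h i
  simp only [Finset.sum_const_zero, ← VSep_eq] at h2
  exact h2

/-! ## Field equations of sigma models -/

section SigmaModel

variable {ι : Type*} [DecidableEq ι]

theorem pd_const (a : ℝ) (i : ι) (u : ι → ℝ) : pd (fun _ => a) i u = 0 := deriv_const _ _

/-- No differentiability is required: where `f` has no derivative and `a ≠ 0`, both sides take the
default value 0. The rescaling of the wave operator below inherits this. -/
theorem pd_const_mul_add (a b : ℝ) (f : (ι → ℝ) → ℝ) (i : ι) (u : ι → ℝ) :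
    pd (fun y => a * f y + b) i u = a * pd f i u := by
  rw [pd, deriv_add_const, deriv_const_mul_field, pd]

theorem StationaryAlong.pd_eq_zero {f : (ι → ℝ) → ℝ} {i : ι} {u : ι → ℝ}
    (h : StationaryAlong f i u) : pd f i u = 0 := h.deriv

/-- The momentum conjugate to a quadratic kinetic term; the symmetry of `G` and of `B` merges the
two cross terms into the factor 2. -/
theorem pd_kinetic {G : Matrix (Fin 4) (Fin 4) ℝ} (hG : G.IsSymm)
    (B : (ι → ℝ) →ₗ[ℝ] (ι → ℝ) →ₗ[ℝ] ℝ) (hB : ∀ v w, B v w = B w v) (a b : ℝ)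
    (p : Fin 4 → ι → ℝ) (κ : Fin 4) (I : ι) :
    pd (fun w => a * (∑ μ, ∑ ν, G μ ν *
        B (Function.update p κ w μ) (Function.update p κ w ν) - b)) I (p κ)
      = a * (2 * ∑ ν, G κ ν * B (Pi.single I 1) (p ν)) := by
  have hupd (s : ℝ) (μ : Fin 4) : Function.update p κ (Function.update (p κ) I s) μ
      = p μ + ((s - p κ I) * if μ = κ then 1 else 0) • Pi.single I 1 := by
    rcases eq_or_ne μ κ with rfl | hμ
    · ext J
      rcases eq_or_ne J I with rfl | hJ
      · simp
      · simp [hJ]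
    · simp [hμ]
  -- An exact expansion in `s - p κ I`: the linear coefficient is the derivative, and the square
  -- contributes nothing at the base point.
  have hexp (s : ℝ) (μ ν : Fin 4) :
      B (Function.update p κ (Function.update (p κ) I s) μ)
        (Function.update p κ (Function.update (p κ) I s) ν)
      = B (p μ) (p ν) + (s - p κ I) * ((if ν = κ then 1 else 0) * B (Pi.single I 1) (p μ)
          + (if μ = κ then 1 else 0) * B (Pi.single I 1) (p ν))
        + (s - p κ I) ^ 2 * ((if μ = κ then 1 else 0) * (if ν = κ then 1 else 0)
          * B (Pi.single I 1) (Pi.single I 1)) := by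
    rw [hupd, hupd]
    simp only [map_add, map_smul, LinearMap.add_apply, LinearMap.smul_apply, smul_eq_mul]
    rw [hB (p μ) (Pi.single I 1)]
    ring
  have h1 : HasDerivAt (fun s => s - p κ I) 1 (p κ I) := (hasDerivAt_id _).sub_const _
  have h2 : HasDerivAt (fun s => (s - p κ I) ^ 2) 0 (p κ I) := by
    simpa using h1.fun_pow 2
  have hd : HasDerivAt (fun s => a * (∑ μ, ∑ ν, G μ ν *
      B (Function.update p κ (Function.update (p κ) I s) μ)
        (Function.update p κ (Function.update (p κ) I s) ν) - b))
      (a * ∑ μ, ∑ ν, G μ ν * (1 * ((if ν = κ then 1 else 0) * B (Pi.single I 1) (p μ)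
          + (if μ = κ then 1 else 0) * B (Pi.single I 1) (p ν)) + 0 * ((if μ = κ then 1 else 0)
          * (if ν = κ then 1 else 0) * B (Pi.single I 1) (Pi.single I 1)))) (p κ I) := by
    simp only [hexp]
    refine ((HasDerivAt.fun_sum fun μ _ => HasDerivAt.fun_sum fun ν _ =>
      HasDerivAt.const_mul _ ?_).sub_const _).const_mul _
    exact ((h1.mul_const _).const_add _).add (h2.mul_const _)
  rw [pd, hd.deriv]
  congr 1
  simp only [one_mul, zero_mul, add_zero, mul_add, Finset.sum_add_distrib, ite_mul, mul_ite,
    mul_zero, Finset.sum_ite_eq', Finset.mem_univ, if_true]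
  rw [Finset.sum_comm (f := fun μ ν => if μ = κ then G μ ν * B (Pi.single I 1) (p ν) else 0)]
  simp only [Finset.sum_ite_eq', Finset.mem_univ, if_true, hG.apply κ]
  ring

/-- The field equations of a sigma model whose metric is given by symmetric bilinear forms. -/
theorem eulerLagrange_sigmaModel {γ : Spacetime → Matrix (Fin 4) (Fin 4) ℝ}
    (hγ : IsSpacetimeMetric γ) {g : (ι → ℝ) → (ι → ℝ) → (ι → ℝ) → ℝ}
    (B : (ι → ℝ) → (ι → ℝ) →ₗ[ℝ] (ι → ℝ) →ₗ[ℝ] ℝ) (hg : ∀ u v w, g u v w = B u v w)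
    (hB : ∀ u v w, g u v w = g u w v) (V : (ι → ℝ) → ℝ) (φ : Spacetime → ι → ℝ) (I : ι)
    (x : Spacetime) : eulerLagrange (sigmaModel γ g V) φ I x
      = ∑ μ, pd (fun y => √|(γ y).det| *
          (2 * ∑ ν, (γ y)⁻¹ μ ν * g (φ y) (Pi.single I 1) (jet φ y ν))) μ x
        - pd (fun u => sigmaModel γ g V x u (jet φ x)) I (φ x) := by
  rw [eulerLagrange]
  congr 1
  refine Finset.sum_congr rfl fun μ _ => ?_
  congr 1
  ext y
  simp only [sigmaModel, hg]
  have hsymm : (γ y)⁻¹.IsSymm := by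
    rw [Matrix.IsSymm, Matrix.transpose_nonsing_inv, (hγ.2 y).1.eq]
  exact pd_kinetic hsymm (B (φ y)) (fun v w => by rw [← hg, ← hg, hB]) _ _ _ μ I

end SigmaModel

/-- The second-order part `2 ∂_μ (√|det γ| γ^{μν} ∂_ν f)` of the field equations. -/
noncomputable def waveOperator (γ : Spacetime → Matrix (Fin 4) (Fin 4) ℝ) (f : Spacetime → ℝ)
    (x : Spacetime) : ℝ :=
  ∑ μ, pd (fun y => √|(γ y).det| * (2 * ∑ ν, (γ y)⁻¹ μ ν * pd f ν y)) μ x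

theorem waveOperator_const (γ : Spacetime → Matrix (Fin 4) (Fin 4) ℝ) (a : ℝ) (x : Spacetime) :
    waveOperator γ (fun _ => a) x = 0 := by
  simp [waveOperator, pd_const]

theorem waveOperator_const_mul_add (γ : Spacetime → Matrix (Fin 4) (Fin 4) ℝ) (a b : ℝ)
    (f : Spacetime → ℝ) (x : Spacetime) :
    waveOperator γ (fun y => a * f y + b) x = a * waveOperator γ f x := by
  rw [waveOperator, waveOperator, Finset.mul_sum]
  refine Finset.sum_congr rfl fun μ _ => ?_
  rw [← pd_const_mul_add a 0]
  congr 1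
  ext y
  simp only [pd_const_mul_add]
  rw [add_zero, mul_left_comm a]
  simp only [Finset.mul_sum]
  refine Finset.sum_congr rfl fun ν _ => ?_
  ring

/-- The field equations of a sigma model with a flat target space. -/
theorem eulerLagrange_flat {κ : Type*} [Fintype κ] [DecidableEq κ]
    {γ : Spacetime → Matrix (Fin 4) (Fin 4) ℝ} (hγ : IsSpacetimeMetric γ) (a : ℝ)
    (V : (κ → ℝ) → ℝ) (ψ : Spacetime → κ → ℝ) (k : κ) (x : Spacetime) :
    eulerLagrange (sigmaModel γ (fun _ v w => a * ∑ i, v i * w i) V) ψ k x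
      = a * waveOperator γ (fun y => ψ y k) x + √|(γ x).det| * pd V k (ψ x) := by
  have hg (v w : κ → ℝ) : a * ∑ i, v i * w i = (a • dotProductBilin ℝ ℝ) v w := by
    simp [dotProduct]
  rw [eulerLagrange_sigmaModel hγ (fun _ => a • dotProductBilin ℝ ℝ) (fun _ => hg)
    (fun _ v w => by simp only [mul_comm])]
  have h1 : pd (fun u => sigmaModel γ (fun _ v w => a * ∑ i, v i * w i) V x u (jet ψ x)) k (ψ x)
      = -√|(γ x).det| * pd V k (ψ x) := by
    rw [← pd_const_mul_add _ (√|(γ x).det| * ∑ μ, ∑ ν, (γ x)⁻¹ μ ν *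
      (a * ∑ i, jet ψ x μ i * jet ψ x ν i))]
    congr 1
    ext u
    rw [sigmaModel]
    ring
  rw [h1, waveOperator, Finset.mul_sum, neg_mul, sub_neg_eq_add]
  congr 1
  refine Finset.sum_congr rfl fun μ _ => ?_
  rw [← pd_const_mul_add a 0]
  congr 1
  ext y
  simp only [Pi.single_apply, ite_mul, one_mul, zero_mul, Finset.sum_ite_eq', Finset.mem_univ,
    if_true, Finset.mul_sum, add_zero]
  refine Finset.sum_congr rfl fun ν _ => ?_
  rw [jet]
  ring

/-! ## Truncations to the dilatons -/

theorem jet_dilatons (H : Spacetime → Fin 3 → ℝ) (x : Spacetime) (μ : Fin 4) :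
    jet (fun y => dilatons (H y)) x μ = dilatons (jet H x μ) := by
  ext c
  cases c with
  | h i => rfl
  | _ => exact pd_const 0 μ x

theorem update_dilatons (h : Fin 3 → ℝ) (i : Fin 3) (s : ℝ) :
    Function.update (dilatons h) (.h i) s = dilatons (Function.update h i s) := by
  ext c
  cases c with
  | h j =>
    rcases eq_or_ne j i with rfl | hj
    · simp [dilatons]
    · have : Coord.h j ≠ Coord.h i := fun h => hj (Coord.h.inj h)
      simp [dilatons, this, hj]
  | _ => simp [dilatons]

/-- The metric on dilaton velocities is the same at all points `u`, so the kinetic term has no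
`u`-derivative even transversally to the locus, and only the potential contributes. -/
theorem pd_sigmaModel_dilatons (γ : Spacetime → Matrix (Fin 4) (Fin 4) ℝ) (V : (Coord → ℝ) → ℝ)
    (x : Spacetime) (w : Fin 4 → Fin 3 → ℝ) (c : Coord) (u : Coord → ℝ) :
    pd (fun u => sigmaModel γ metric V x u (fun μ => dilatons (w μ))) c u
      = -√|(γ x).det| * pd V c u := by
  rw [← pd_const_mul_add _ (√|(γ x).det| * ∑ μ, ∑ ν, (γ x)⁻¹ μ ν * ∑ i, w μ i * w ν i)]
  congr 1
  ext u
  simp only [sigmaModel, metric_dilatons_dilatons]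
  ring

section Truncation

variable {γ : Spacetime → Matrix (Fin 4) (Fin 4) ℝ} {V : (Coord → ℝ) → ℝ} {V' : (Fin 3 → ℝ) → ℝ}

theorem eulerLagrange_dilatons (hγ : IsSpacetimeMetric γ) (V : (Coord → ℝ) → ℝ)
    (H : Spacetime → Fin 3 → ℝ) (c : Coord) (x : Spacetime) :
    eulerLagrange (sigmaModel γ metric V) (fun y => dilatons (H y)) c x
      = ∑ μ, pd (fun y => √|(γ y).det| * (2 * ∑ ν, (γ y)⁻¹ μ ν *
          metric (dilatons (H y)) (Pi.single c 1) (dilatons (jet H y ν)))) μ x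
        + √|(γ x).det| * pd V c (dilatons (H x)) := by
  have hjet (y : Spacetime) : jet (fun y => dilatons (H y)) y = fun ν => dilatons (jet H y ν) :=
    funext fun ν => jet_dilatons H y ν
  rw [eulerLagrange_sigmaModel hγ metricForm metric_eq metric_comm]
  simp only [hjet, pd_sigmaModel_dilatons, neg_mul, sub_neg_eq_add]

theorem eulerLagrange_dilatons_h (hγ : IsSpacetimeMetric γ) (hV' : ∀ h, V (dilatons h) = V' h)
    (H : Spacetime → Fin 3 → ℝ) (i : Fin 3) (x : Spacetime) :
    eulerLagrange (sigmaModel γ metric V) (fun y => dilatons (H y)) (.h i) x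
      = waveOperator γ (fun y => H y i) x + √|(γ x).det| * pd V' i (H x) := by
  rw [eulerLagrange_dilatons hγ]
  have h1 : pd V (.h i) (dilatons (H x)) = pd V' i (H x) := by
    simp only [pd, update_dilatons, hV']
    rfl
  have h2 : (Pi.single (.h i) 1 : Coord → ℝ) = dilatons (Pi.single i 1) := by
    rw [Pi.single, Pi.single, ← update_dilatons]
    congr 1
    ext c
    cases c <;> rfl
  rw [h1, h2]
  simp only [metric_dilatons_dilatons, Pi.single_apply, ite_mul, one_mul, zero_mul,
    Finset.sum_ite_eq', Finset.mem_univ, if_true]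
  rfl

/-- Orthogonality to the dilatons removes the second-order part along the whole configuration, and
stationarity removes the force. -/
theorem eulerLagrange_dilatons_of_ne (hγ : IsSpacetimeMetric γ)
    (hV : ∀ (h : Fin 3 → ℝ) (c : Coord), (∀ j, c ≠ .h j) → StationaryAlong V c (dilatons h))
    (H : Spacetime → Fin 3 → ℝ) {c : Coord} (hc : ∀ j, c ≠ .h j) (x : Spacetime) :
    eulerLagrange (sigmaModel γ metric V) (fun y => dilatons (H y)) c x = 0 := by
  rw [eulerLagrange_dilatons hγ, (hV _ c hc).pd_eq_zero]
  simp [metric_single_dilatons _ _ hc, pd_const]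

theorem forall_eulerLagrange_dilatons (hγ : IsSpacetimeMetric γ)
    (hV : ∀ (h : Fin 3 → ℝ) (c : Coord), (∀ j, c ≠ .h j) → StationaryAlong V c (dilatons h))
    (hV' : ∀ h, V (dilatons h) = V' h) (H : Spacetime → Fin 3 → ℝ) (x : Spacetime) :
    (∀ c, eulerLagrange (sigmaModel γ metric V) (fun y => dilatons (H y)) c x = 0)
      ↔ ∀ i, waveOperator γ (fun y => H y i) x + √|(γ x).det| * pd V' i (H x) = 0 := by
  constructor
  · intro h i
    rw [← eulerLagrange_dilatons_h hγ hV']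
    exact h (.h i)
  · intro h c
    by_cases hc : ∀ j, c ≠ .h j
    · exact eulerLagrange_dilatons_of_ne hγ hV H hc x
    · push Not at hc
      obtain ⟨i, rfl⟩ := hc
      rw [eulerLagrange_dilatons_h hγ hV']
      exact h i

theorem pullback_dilatons (hV' : ∀ h, V (dilatons h) = V' h) :
    pullback (sigmaModel γ metric V) dilatons
      = sigmaModel γ (fun _ v w => ∑ i, v i * w i) V' := by
  ext x s w
  have h1 (μ : Fin 4) : (fun I => ∑ k, pd (fun s' => dilatons s' I) k s * w μ k)
      = dilatons (w μ) := by
    ext c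
    cases c with
    | h i =>
      have (k : Fin 3) : pd (fun s' : Fin 3 → ℝ => dilatons s' (.h i)) k s
          = if k = i then 1 else 0 := by
        simp only [pd, dilatons]
        split_ifs with h
        · rw [h]
          simp
        · simp [Function.update_of_ne (Ne.symm h)]
      simp only [this]
      simp [dilatons]
    | _ => simp [dilatons, pd_const]
  rw [pullback]
  simp only [h1, sigmaModel, metric_dilatons_dilatons, hV']

theorem isConsistentTruncation_dilatons (hγ : IsSpacetimeMetric γ)
    (hV : ∀ (h : Fin 3 → ℝ) (c : Coord), (∀ j, c ≠ .h j) → StationaryAlong V c (dilatons h))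
    (hV' : ∀ h, V (dilatons h) = V' h) :
    IsConsistentTruncation (sigmaModel γ metric V) dilatons := by
  intro ψ _ x
  have h := eulerLagrange_flat hγ 1 V' ψ
  simp only [one_mul] at h
  rw [forall_eulerLagrange_dilatons hγ hV hV' ψ x, pullback_dilatons hV']
  simp only [h]

/-! ## Truncations to one field -/

variable {β c : Fin 3 → ℝ}

/-- The dilatons on the one-field locus. -/
noncomputable def oneFieldDilatons (β c : Fin 3 → ℝ) (φ : ℝ) (i : Fin 3) : ℝ :=
  if β i = 0 then c i else φ / √(2 * active β) + Real.log |β i| / 2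

theorem oneField_eq (β c : Fin 3 → ℝ) (φ : Unit → ℝ) :
    oneField β c φ = dilatons (oneFieldDilatons β c (φ ())) := rfl

theorem active_pos (hβ : β ≠ 0) : 0 < active β := by
  obtain ⟨i, hi⟩ := Function.ne_iff.1 hβ
  exact Finset.card_pos.2 ⟨i, by simpa using hi⟩

theorem sqrt_active_pos (hβ : β ≠ 0) : 0 < √(2 * active β) := by
  have : (0 : ℝ) < active β := by exact_mod_cast active_pos hβ
  positivity

theorem sq_sqrt_active (β : Fin 3 → ℝ) : √(2 * active β) ^ 2 = 2 * active β :=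
  Real.sq_sqrt (by positivity)

theorem sum_ite_active (β : Fin 3 → ℝ) (a : ℝ) :
    ∑ i, (if β i = 0 then 0 else a) = active β * a := by
  rw [active, ← nsmul_eq_mul, ← Finset.sum_const, Finset.sum_filter]
  simp only [ne_eq, ite_not]

theorem pullback_oneField (hβ : β ≠ 0) (hV' : ∀ h, V (dilatons h) = V' h) {Veff : ℝ → ℝ}
    (hVeff : ∀ φ, V' (oneFieldDilatons β c φ) = Veff φ) :
    pullback (sigmaModel γ metric V) (oneField β c)
      = sigmaModel γ (fun _ v w => 1 / 2 * (v () * w ())) fun φ => Veff (φ ()) := by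
  ext x s w
  have h1 (μ : Fin 4) : (fun I => ∑ k, pd (fun s' => oneField β c s' I) k s * w μ k)
      = dilatons fun i => if β i = 0 then 0 else w μ () / √(2 * active β) := by
    ext d
    cases d with
    | h i =>
      simp only [oneField, dilatons, Finset.univ_unique, Finset.sum_singleton]
      split_ifs with h
      · simp [pd_const]
      · have := pd_const_mul_add (1 / √(2 * active β)) (Real.log |β i| / 2)
          (fun s' : Unit → ℝ => s' ()) () s
        have h2 : (fun s' : Unit → ℝ => s' () / √(2 * active β) + Real.log |β i| / 2)
            = fun s' => 1 / √(2 * active β) * s' () + Real.log |β i| / 2 := by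
          simp only [one_div_mul_eq_div]
        change pd _ () s * w μ () = _
        rw [h2, this, mul_assoc]
        have h1 : pd (fun s' : Unit → ℝ => s' ()) () s = 1 := by simp [pd]
        rw [h1, one_mul, one_div_mul_eq_div]
    | _ => simp [oneField, dilatons, pd_const]
  -- Each of the `q` active dilatons contributes `1/(2q)`.
  have h2 (a b : ℝ) : ∑ i, (if β i = 0 then 0 else a / √(2 * active β))
      * (if β i = 0 then 0 else b / √(2 * active β)) = 1 / 2 * (a * b) := by
    have : (active β : ℝ) ≠ 0 := by exact_mod_cast (active_pos hβ).ne'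
    simp only [ite_mul, mul_ite, zero_mul, mul_zero]
    have h3 : ∀ i, (if β i = 0 then 0 else if β i = 0 then 0
        else a / √(2 * active β) * (b / √(2 * active β)))
        = if β i = 0 then 0 else a / √(2 * active β) * (b / √(2 * active β)) := by
      intro i; split_ifs <;> rfl
    simp only [h3]
    rw [sum_ite_active, div_mul_div_comm, ← sq, sq_sqrt_active]
    field_simp
  refine (congrArg (sigmaModel γ metric V x (oneField β c s)) (funext h1)).trans ?_
  simp only [sigmaModel, metric_dilatons_dilatons, h2, oneField_eq, hV', hVeff]

/-- The factor `2/√(2q)` in `hne` is forced by the chain rule: `q` equal partial derivatives, each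
weighted with `1/√(2q)`, must add up to `Veff'`. It is also the ratio between each active dilaton
equation and the equation for `φ`, so any single active index recovers the latter. -/
theorem isConsistentTruncation_oneField (hγ : IsSpacetimeMetric γ) (hβ : β ≠ 0)
    (hV : ∀ (h : Fin 3 → ℝ) (c : Coord), (∀ j, c ≠ .h j) → StationaryAlong V c (dilatons h))
    (hV' : ∀ h, V (dilatons h) = V' h) {Veff : ℝ → ℝ}
    (hVeff : ∀ φ, V' (oneFieldDilatons β c φ) = Veff φ)
    (hzero : ∀ φ i, β i = 0 → pd V' i (oneFieldDilatons β c φ) = 0)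
    (hne : ∀ φ i, β i ≠ 0 →
      pd V' i (oneFieldDilatons β c φ) = 2 / √(2 * active β) * deriv Veff φ) :
    IsConsistentTruncation (sigmaModel γ metric V) (oneField β c) := by
  intro ψ _ x
  have hr := sqrt_active_pos hβ
  have h := eulerLagrange_flat hγ (1 / 2) (fun φ : Unit → ℝ => Veff (φ ())) ψ
  have hpd : pd (fun φ : Unit → ℝ => Veff (φ ())) () (ψ x) = deriv Veff (ψ x ()) := by
    simp [pd]
  simp only [Finset.univ_unique, Finset.sum_singleton, PUnit.default_eq_unit] at h
  simp only [oneField_eq]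
  rw [forall_eulerLagrange_dilatons hγ hV hV' _ x, pullback_oneField hβ hV' hVeff]
  simp only [h, hpd]
  have hi (i : Fin 3) (hi : β i ≠ 0) :
      waveOperator γ (fun y => oneFieldDilatons β c (ψ y ()) i) x
        + √|(γ x).det| * pd V' i (oneFieldDilatons β c (ψ x ()))
      = 2 / √(2 * active β) * (1 / 2 * waveOperator γ (fun y => ψ y ()) x
        + √|(γ x).det| * deriv Veff (ψ x ())) := by
    have h1 : (fun y => oneFieldDilatons β c (ψ y ()) i)
        = fun y => 1 / √(2 * active β) * ψ y () + Real.log |β i| / 2 := by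
      ext y
      rw [oneFieldDilatons, if_neg hi, one_div_mul_eq_div]
    rw [hne _ _ hi, h1, waveOperator_const_mul_add]
    ring
  constructor
  · intro hall k
    obtain ⟨i, hβi⟩ := Function.ne_iff.1 hβ
    have := hall i
    rw [hi i hβi] at this
    exact (mul_eq_zero.1 this).resolve_left (by positivity)
  · intro heff i
    by_cases hβi : β i = 0
    · have h1 : (fun y => oneFieldDilatons β c (ψ y ()) i) = fun _ => c i := by
        ext y
        rw [oneFieldDilatons, if_pos hβi]
      rw [hzero _ _ hβi, h1, waveOperator_const, mul_zero, add_zero]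
    · rw [hi i hβi, heff (), mul_zero]

end Truncation

/-! ## The one-field potentials -/

theorem hasDerivAt_update_exp (β : Fin 3 → ℝ) (h : Fin 3 → ℝ) (i j : Fin 3) :
    HasDerivAt (fun s => β j * Real.exp (-2 * Function.update h i s j))
      (if j = i then -2 * (β i * Real.exp (-2 * h i)) else 0) (h i) := by
  split_ifs with hj
  · subst hj
    simp only [Function.update_self]
    have h1 := (((hasDerivAt_id' (h j)).const_mul (-2)).exp.const_mul (β j))
    exact h1.congr_deriv (by ring)
  · simp only [Function.update_of_ne hj]
    exact hasDerivAt_const _ _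

theorem pd_VSTU (β : Fin 3 → ℝ) (κ : ℝ) (h : Fin 3 → ℝ) (i : Fin 3) :
    pd (fun h => 9 / 4 * (2 * κ - √2 * ∑ i, β i * Real.exp (-2 * h i)) ^ 2) i h
      = 9 * √2 * (β i * Real.exp (-2 * h i))
        * (2 * κ - √2 * ∑ i, β i * Real.exp (-2 * h i)) := by
  have h1 := HasDerivAt.fun_sum (u := Finset.univ) fun j _ => hasDerivAt_update_exp β h i j
  have h2 := (((h1.const_mul √2).const_sub (2 * κ)).fun_pow 2).const_mul (9 / 4)
  rw [pd, h2.deriv]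
  simp only [Finset.sum_ite_eq', Finset.mem_univ, if_true, Function.update_eq_self]
  push_cast
  ring

theorem pd_VSep (β κ : Fin 3 → ℝ) (h : Fin 3 → ℝ) (i : Fin 3) :
    pd (fun h => 9 / 4 * ∑ i, (2 * κ i - √2 * Real.exp (-2 * h i) * β i) ^ 2) i h
      = 9 * √2 * (β i * Real.exp (-2 * h i))
        * (2 * κ i - √2 * (β i * Real.exp (-2 * h i))) := by
  have h1 := (HasDerivAt.fun_sum (u := Finset.univ) fun j _ =>
    ((((hasDerivAt_update_exp β h i j).const_mul √2).const_sub (2 * κ j)).fun_pow 2)).const_mul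
      (9 / 4)
  have h3 (s : ℝ) (j : Fin 3) : √2 * Real.exp (-2 * Function.update h i s j) * β j
      = √2 * (β j * Real.exp (-2 * Function.update h i s j)) := by ring
  simp only [pd, h3]
  rw [h1.deriv, Finset.sum_eq_single i]
  · simp only [if_true, Function.update_eq_self]
    push_cast
    ring
  · intro j _ hj
    simp [hj]
  · simp

/-- The shift `½ log|β_i|` divides out the modulus of `β_i`, leaving its sign; for `β_i = 0` both
sides vanish, whatever `c i` is. -/
theorem exp_oneFieldDilatons (β c : Fin 3 → ℝ) (φ : ℝ) (i : Fin 3) :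
    β i * Real.exp (-2 * oneFieldDilatons β c φ i)
      = SignType.sign (β i) * Real.exp (-(2 / √(2 * active β)) * φ) := by
  rw [oneFieldDilatons]
  split_ifs with h
  · simp [h]
  · have h1 : -2 * (φ / √(2 * active β) + Real.log |β i| / 2)
        = -(2 / √(2 * active β)) * φ - Real.log |β i| := by ring
    have h2 : (0 : ℝ) < |β i| := abs_pos.2 h
    have h3 : β i = SignType.sign (β i) * |β i| := (sign_mul_abs (β i)).symm
    rw [h1, Real.exp_sub, Real.exp_log h2]
    nth_rewrite 1 [h3]
    field_simp

theorem sqrt_exponent {β : Fin 3 → ℝ} (hβ : β ≠ 0) :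
    √(2 / (3 * (active β / 3 : ℝ))) = 2 / √(2 * active β) := by
  have h : (0 : ℝ) < active β := by exact_mod_cast active_pos hβ
  have hr := sqrt_active_pos hβ
  rw [Real.sqrt_eq_iff_mul_self_eq_of_pos (by positivity), div_mul_div_comm, ← sq √_, sq_sqrt_active]
  field_simp

theorem isStarobinskyLike_of_pos {α a b C : ℝ} (hα : 0 < α) (ha : a ≠ 0) (hab : 0 < b / a)
    (hC : 0 < C) :
    IsStarobinskyLike α fun φ => C * (a - b * Real.exp (-√(2 / (3 * α)) * φ)) ^ 2 := by
  have hs : √(2 / (3 * α)) ≠ 0 := by positivity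
  -- Factoring out `a` leaves `1 - (b/a) e^{-λφ}`, and the positive number `b/a` is absorbed by the
  -- shift `φ₀ = log(b/a)/λ`.
  refine ⟨C * a ^ 2, by positivity, Real.log (b / a) / √(2 / (3 * α)), fun φ => ?_⟩
  have h1 : -√(2 / (3 * α)) * (φ - Real.log (b / a) / √(2 / (3 * α)))
      = -√(2 / (3 * α)) * φ + Real.log (b / a) := by
    field_simp
    ring
  rw [h1, Real.exp_add, Real.exp_log hab]
  field_simp

theorem active_cases {β : Fin 3 → ℝ} (hβ : β ≠ 0) :
    active β = 1 ∨ active β = 2 ∨ active β = 3 := by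
  have h1 := active_pos hβ
  have h2 : active β ≤ 3 := (Finset.card_filter_le _ _).trans (by simp)
  omega

theorem hasDerivAt_exponential_potential (a b r φ : ℝ) :
    HasDerivAt (fun φ => (a - b * Real.exp (-r * φ)) ^ 2)
      (2 * (a - b * Real.exp (-r * φ)) * (b * r * Real.exp (-r * φ))) φ := by
  have h := (((((hasDerivAt_id' φ).const_mul (-r)).exp).const_mul b).const_sub a).fun_pow 2
  exact h.congr_deriv (by push_cast; ring)

/-- With a common sign `ε` all active `β_i e^{-2h_i}` are the same function of `φ`. Since the other
factor of `∂_iV` is the common `2κ - √2 ∑`, the active forces agree. -/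
theorem truncation_VSTU {β : Fin 3 → ℝ} (c : Fin 3 → ℝ) {κ ε : ℝ} (hβ : β ≠ 0)
    (hε : ε = 1 ∨ ε = -1) (hsign : ∀ i, 0 ≤ ε * β i) {V : ℝ → ℝ}
    (hV : ∀ φ, V φ = 9 / 4 * (2 * κ - √2 * ε * active β
      * Real.exp (-(2 / √(2 * active β)) * φ)) ^ 2)
    {γ : Spacetime → Matrix (Fin 4) (Fin 4) ℝ} (hγ : IsSpacetimeMetric γ) :
    IsConsistentTruncation (sigmaModel γ metric (VSTU β κ)) (oneField β c) ∧
      pullback (sigmaModel γ metric (VSTU β κ)) (oneField β c)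
        = sigmaModel γ (fun _ v w => 1 / 2 * (v () * w ())) fun φ => V (φ ()) := by
  have hs (i : Fin 3) : ((SignType.sign (β i) : SignType) : ℝ) = if β i = 0 then 0 else ε := by
    split_ifs with h
    · simp [h]
    · rcases hε with rfl | rfl
      · rw [sign_pos (lt_of_le_of_ne (by simpa using hsign i) (Ne.symm h))]
        simp
      · rw [sign_neg (lt_of_le_of_ne (by simpa using hsign i) h)]
        simp
  have hsum (φ : ℝ) : ∑ i, β i * Real.exp (-2 * oneFieldDilatons β c φ i)
      = active β * (ε * Real.exp (-(2 / √(2 * active β)) * φ)) := by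
    simp only [exp_oneFieldDilatons, hs, ite_mul, zero_mul, sum_ite_active]
  have hVeff (φ : ℝ) : 9 / 4 * (2 * κ - √2 *
      ∑ i, β i * Real.exp (-2 * oneFieldDilatons β c φ i)) ^ 2 = V φ := by
    rw [hsum, hV]
    ring
  have hV' := VSTU_dilatons β κ
  refine ⟨isConsistentTruncation_oneField hγ hβ (fun h c => stationaryAlong_dilatons β κ h)
    hV' hVeff (fun φ i hi => ?_) (fun φ i hi => ?_), pullback_oneField hβ hV' hVeff⟩
  · rw [pd_VSTU, hi]
    ring
  · have hd := (hasDerivAt_exponential_potential (2 * κ) (√2 * ε * active β)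
      (2 / √(2 * active β)) φ).const_mul (9 / 4)
    rw [pd_VSTU, hsum, exp_oneFieldDilatons, hs, if_neg hi, funext hV, hd.deriv]
    -- One factor comes from the exponent, one from the normalisation of the dilaton equation, and
    -- `q` from the sum over active terms.
    have h1 : (2 / √(2 * active β)) * (2 / √(2 * active β)) * active β = 2 := by
      rw [div_mul_div_comm, ← sq √_, sq_sqrt_active]
      have : (active β : ℝ) ≠ 0 := by exact_mod_cast (active_pos hβ).ne'
      field_simp
    linear_combination (-(9 / 2 : ℝ) * (2 * κ - √2 * ε * active β
      * Real.exp (-(2 / √(2 * active β)) * φ)) * √2 * ε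
      * Real.exp (-(2 / √(2 * active β)) * φ)) * h1

/-- For active `i` both `κ_i` and `β_i e^{-2h_i}` carry `sign(β_i)`. The sign drops out of the
square and of `∂_iV`, so mixed signs are allowed; inactive terms only add constants. -/
theorem truncation_VSep {β κ : Fin 3 → ℝ} (c : Fin 3 → ℝ) {k : ℝ} (hβ : β ≠ 0)
    (hκ : ∀ i, β i ≠ 0 → κ i = k * SignType.sign (β i)) {V : ℝ → ℝ}
    (hV : ∀ φ, V φ = 9 / 4 * active β * (2 * k - √2
      * Real.exp (-(2 / √(2 * active β)) * φ)) ^ 2 + 9 * ∑ i with β i = 0, κ i ^ 2)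
    {γ : Spacetime → Matrix (Fin 4) (Fin 4) ℝ} (hγ : IsSpacetimeMetric γ) :
    IsConsistentTruncation (sigmaModel γ metric (VSep β κ)) (oneField β c) ∧
      pullback (sigmaModel γ metric (VSep β κ)) (oneField β c)
        = sigmaModel γ (fun _ v w => 1 / 2 * (v () * w ())) fun φ => V (φ ()) := by
  have hs (i : Fin 3) (hi : β i ≠ 0) :
      ((SignType.sign (β i) : SignType) : ℝ) * (SignType.sign (β i) : SignType) = 1 := by
    rcases lt_or_gt_of_ne hi with h | h
    · simp [sign_neg h]
    · simp [sign_pos h]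
  have hterm (φ : ℝ) (i : Fin 3) : (2 * κ i - √2
      * (β i * Real.exp (-2 * oneFieldDilatons β c φ i))) ^ 2
      = (if β i = 0 then 0 else (2 * k - √2 * Real.exp (-(2 / √(2 * active β)) * φ)) ^ 2)
        + 4 * if β i = 0 then κ i ^ 2 else 0 := by
    rw [exp_oneFieldDilatons]
    split_ifs with h
    · simp [h]
      ring
    · rw [hκ i h]
      linear_combination ((2 * k - √2 * Real.exp (-(2 / √(2 * active β)) * φ)) ^ 2) * hs i h
  have hVeff (φ : ℝ) : 9 / 4 * ∑ i, (2 * κ i - √2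
      * Real.exp (-2 * oneFieldDilatons β c φ i) * β i) ^ 2 = V φ := by
    have h1 (i : Fin 3) : √2 * Real.exp (-2 * oneFieldDilatons β c φ i) * β i
      = √2 * (β i * Real.exp (-2 * oneFieldDilatons β c φ i)) := by ring
    simp only [h1, hterm]
    rw [Finset.sum_add_distrib, sum_ite_active, ← Finset.mul_sum, ← Finset.sum_filter, hV]
    ring
  have hV' := VSep_dilatons β κ
  refine ⟨isConsistentTruncation_oneField hγ hβ
    (fun h c hc => .VSep fun i => stationaryAlong_dilatons _ _ h hc)
    hV' hVeff (fun φ i hi => ?_) (fun φ i hi => ?_), pullback_oneField hβ hV' hVeff⟩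
  · rw [pd_VSep, hi]
    ring
  · have hd := ((hasDerivAt_exponential_potential (2 * k) √2
      (2 / √(2 * active β)) φ).const_mul (9 / 4 * (active β : ℝ))).add_const
        (9 * ∑ i with β i = 0, κ i ^ 2)
    rw [pd_VSep, exp_oneFieldDilatons, hκ i hi, funext hV, hd.deriv]
    have h1 : (2 / √(2 * active β)) * (2 / √(2 * active β)) * active β = 2 := by
      rw [div_mul_div_comm, ← sq √_, sq_sqrt_active]
      have : (active β : ℝ) ≠ 0 := by exact_mod_cast (active_pos hβ).ne'
      field_simp
    linear_combination (-(9 / 2 : ℝ) * (2 * k - √2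
      * Real.exp (-(2 / √(2 * active β)) * φ)) * √2
      * Real.exp (-(2 / √(2 * active β)) * φ)) * h1
      + 9 * √2 * Real.exp (-(2 / √(2 * active β)) * φ)
        * (2 * k - √2 * Real.exp (-(2 / √(2 * active β)) * φ)) * hs i hi

end MultiStar

/-! ### The main theorem -/

open MultiStar in
theorem mainTheorem3 :
    -- the separately gauged generators commute
    (∀ (β κ : Fin 3 → ℝ) (i j : Fin 3), ⁅tSep β κ i, tSep β κ j⁆ = 0) ∧
    -- the gauging of `t_STU`: consistent truncation to three dilatons
    (∀ (β : Fin 3 → ℝ) (κ : ℝ),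
      (∀ u : Coord → ℝ, u .U = 0 → u .a = 0 → (∀ m, u (.Z m) = 0) →
        (∀ m, StationaryAlong (VSTU β κ) (.Z m) u) ∧ StationaryAlong (VSTU β κ) .U u ∧
        StationaryAlong (VSTU β κ) .a u) ∧
      (∀ (h : Fin 3 → ℝ) (r : Fin 9), StationaryAlong (VSTU β κ) (.p r) (dilatons h)) ∧
      (∀ h : Fin 3 → ℝ, VSTU β κ (dilatons h)
        = 9 / 4 * (2 * κ - √2 * ∑ i, β i * Real.exp (-2 * h i)) ^ 2) ∧
      ∀ γ, IsSpacetimeMetric γ →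
        IsConsistentTruncation (sigmaModel γ metric (VSTU β κ)) dilatons ∧
        pullback (sigmaModel γ metric (VSTU β κ)) dilatons
          = sigmaModel γ (fun _ v w => ∑ i, v i * w i) fun h =>
              9 / 4 * (2 * κ - √2 * ∑ i, β i * Real.exp (-2 * h i)) ^ 2) ∧
    -- the separate gauging: consistent truncation to three dilatons
    (∀ β κ : Fin 3 → ℝ,
      (∀ u : Coord → ℝ, u .U = 0 → u .a = 0 → (∀ m, u (.Z m) = 0) →
        (∀ m, StationaryAlong (VSep β κ) (.Z m) u) ∧ StationaryAlong (VSep β κ) .U u ∧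
        StationaryAlong (VSep β κ) .a u) ∧
      (∀ (h : Fin 3 → ℝ) (r : Fin 9), StationaryAlong (VSep β κ) (.p r) (dilatons h)) ∧
      (∀ h : Fin 3 → ℝ, VSep β κ (dilatons h)
        = 9 / 4 * ∑ i, (2 * κ i - √2 * Real.exp (-2 * h i) * β i) ^ 2) ∧
      ∀ γ, IsSpacetimeMetric γ →
        IsConsistentTruncation (sigmaModel γ metric (VSep β κ)) dilatons ∧
        pullback (sigmaModel γ metric (VSep β κ)) dilatons
          = sigmaModel γ (fun _ v w => ∑ i, v i * w i) fun h =>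
              9 / 4 * ∑ i, (2 * κ i - √2 * Real.exp (-2 * h i) * β i) ^ 2) ∧
    -- the values of `α`
    (∀ β : Fin 3 → ℝ, β ≠ 0 → active β = 1 ∨ active β = 2 ∨ active β = 3) ∧
    -- the gauging of `t_STU`: one-field truncation with `α = q/3`
    (∀ (β c : Fin 3 → ℝ) (κ ε : ℝ), β ≠ 0 → (ε = 1 ∨ ε = -1) → (∀ i, 0 ≤ ε * β i) →
      ∀ α : ℝ, α = active β / 3 → ∀ V : ℝ → ℝ,
      (∀ φ, V φ =
        9 / 4 * (2 * κ - √2 * ε * active β * Real.exp (-√(2 / (3 * α)) * φ)) ^ 2) →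
      (∀ γ, IsSpacetimeMetric γ →
        IsConsistentTruncation (sigmaModel γ metric (VSTU β κ)) (oneField β c) ∧
        pullback (sigmaModel γ metric (VSTU β κ)) (oneField β c)
          = sigmaModel γ (fun _ v w => 1 / 2 * (v () * w ())) fun φ => V (φ ())) ∧
      (0 < ε * κ → IsStarobinskyLike α V)) ∧
    -- the separate gauging: one-field truncation with `α = q/3`
    (∀ (β κ c : Fin 3 → ℝ) (k : ℝ), β ≠ 0 → (∀ i, β i ≠ 0 → κ i = k * SignType.sign (β i)) →
      ∀ α : ℝ, α = active β / 3 → ∀ V : ℝ → ℝ,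
      (∀ φ, V φ =
        9 / 4 * active β * (2 * k - √2 * Real.exp (-√(2 / (3 * α)) * φ)) ^ 2
          + 9 * ∑ i with β i = 0, κ i ^ 2) →
      (∀ γ, IsSpacetimeMetric γ →
        IsConsistentTruncation (sigmaModel γ metric (VSep β κ)) (oneField β c) ∧
        pullback (sigmaModel γ metric (VSep β κ)) (oneField β c)
          = sigmaModel γ (fun _ v w => 1 / 2 * (v () * w ())) fun φ => V (φ ())) ∧
      (0 < k → (∀ i, β i = 0 → κ i = 0) → IsStarobinskyLike α V)) := by
  refine ⟨fun β κ i j => ?_, fun β κ => ⟨fun u hU ha hZ => ⟨stationaryAlong_Z β κ ha hZ,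
    stationaryAlong_U β κ hU ha hZ, stationaryAlong_a β κ hU ha hZ⟩, stationaryAlong_p β κ,
    VSTU_dilatons β κ, fun γ hγ => ⟨isConsistentTruncation_dilatons hγ
      (fun h c => stationaryAlong_dilatons β κ h) (VSTU_dilatons β κ),
      pullback_dilatons (VSTU_dilatons β κ)⟩⟩,
    fun β κ => ⟨fun u hU ha hZ => ⟨fun m => .VSep fun i => stationaryAlong_Z _ _ ha hZ m,
    .VSep fun i => stationaryAlong_U _ _ hU ha hZ, .VSep fun i => stationaryAlong_a _ _ hU ha hZ⟩,
    fun h r => .VSep fun i => stationaryAlong_p _ _ h r,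
    VSep_dilatons β κ, fun γ hγ => ⟨isConsistentTruncation_dilatons hγ
      (fun h c hc => .VSep fun i => stationaryAlong_dilatons _ _ h hc) (VSep_dilatons β κ),
      pullback_dilatons (VSep_dilatons β κ)⟩⟩,
    fun β => active_cases, fun β c κ ε hβ hε hsign α hα V hV => ⟨fun γ hγ => ?_, fun hκ => ?_⟩,
    fun β κ c k hβ hκ α hα V hV => ⟨fun γ hγ => ?_, fun hk hzero => ?_⟩⟩
  · exact sub_eq_zero.2 (commute_tSep β κ i j).eq
  · simp only [hα, sqrt_exponent hβ] at hV
    exact truncation_VSTU c hβ hε hsign hV hγ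
  · have hq : (0 : ℝ) < active β := by exact_mod_cast active_pos hβ
    have hα0 : 0 < α := by rw [hα]; positivity
    rw [funext hV]
    have hκ0 : κ ≠ 0 := right_ne_zero_of_mul hκ.ne'
    refine isStarobinskyLike_of_pos hα0 (mul_ne_zero two_ne_zero hκ0) ?_ (by norm_num)
    -- Expanding the fraction by `κ` exhibits its sign as that of `ε * κ`.
    have h1 : √2 * ε * active β / (2 * κ) = √2 * active β * (ε * κ) / (2 * κ ^ 2) := by
      field_simp
    rw [h1]
    positivity
  · simp only [hα, sqrt_exponent hβ] at hV
    exact truncation_VSep c hβ hκ hV hγ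
  · have hq : (0 : ℝ) < active β := by exact_mod_cast active_pos hβ
    have hα0 : 0 < α := by rw [hα]; positivity
    have h0 : ∑ i with β i = 0, κ i ^ 2 = 0 :=
      Finset.sum_eq_zero fun i hi => by rw [hzero i (Finset.mem_filter.1 hi).2]; norm_num
    simp only [h0, mul_zero, add_zero] at hV
    rw [funext hV]
    exact isStarobinskyLike_of_pos hα0 (by positivity) (by positivity) (by positivity)
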